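/- Conventions. Let $Y$ be a topological space and $k\ge 0$ an integer. For open sets $A_1,A_2\subseteq Y\times\mathbb R^k$, a continuous map $f\colon A_1\to A_2$ of the form $f(y,w)=(y,f^y(w))$ is of class $C^{0,\infty}$ if, whenever $U_i\subseteq Y$, $V_i\subseteq\mathbb R^k$ are open with $U_i\times V_i\subseteq A_i$ and $f(U_1\times V_1)\subseteq U_2\times V_2$, the map $y\mapsto f^y|_{V_1}$ is continuous from $U_1$ into $C^\infty(V_1,V_2)$ (topology of uniform convergence on compacta of all derivatives). A continuous family over $Y$, with fibers of dimension $k$, is a continuous open surjection $p\colon X\to Y$ of locally compact Hausdorff spaces with an atlas: an open cover $(U_\alpha)$ of $X$ and homeomorphisms $\phi_\alpha$ of $U_\alpha$ onto open subsets of $Y\times\mathbb R^k$, compatible with $p$ and the projection to $Y$, all of whose transition maps are of class $C^{0,\infty}$ together with their inverses. Its charts are the elements of the associated maximal atlas. A chart $U$ is of product form if its image is $p(U)\times W$ with $W\subseteq\mathbb R^k$ open. For $t\colon Z\to Y$ continuous, $Z$ locally compact Hausdorff, the pull-back $\{(z,x): t(z)=p(x)\}\to Z$ is a continuous family with the charts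 $(z,x)\mapsto(z,h(x))$, where $x\mapsto(p(x),h(x))$ is a chart of $X$. A morphism from $p_1\colon X_1\to Y_1$ to $p_2\colon X_2\to Y_2$ with respect to a continuous map $q\colon Y_1\to Y_2$ is a continuous map $f\colon X_1\to X_2$ with $p_2f=qp_1$ such that for every $x\in X_1$ and every product chart $U_2\sim p_2(U_2)\times W_2$ containing $f(x)$ there is a product chart $U_1\sim p_1(U_1)\times W_1$ containing $x$ with $f(U_1)\subseteq U_2$ for which, in local coordinates, $f(y,w)=(q(y),f^y(w))$ with $y\mapsto f^y$ continuous from $p_1(U_1)$ into $C^\infty(W_1,W_2)$. A locally compact groupoid is a groupoid $G$ (with $r(x)=xx^{-1}$, $s(x)=x^{-1}x$, unit space $G^0=r(G)$) with a second countable locally compact Hausdorff topology for which multiplication and inversion are continuous. It is a continuous family groupoid if $(G,r)$ and $(G,s)$ are (equipped with structures of) continuous families over $G^0$ with fibers of dimension $k$, inversion is an isomorphism of continuous families from $(G,s)$ to $(G,r)$ over the identity of $G^0$, and multiplication $(x,y)\mapsto xy$ is a morphism with respect to $r\colon G\to G^0$ from $\{(x,y): s(x)=r(y)\}$, a continuous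 family over $G$ under $(x,y)\mapsto x$ as the pull-back of $(G,r)$ along $s$, to $(G,r)$. A left Haar system on $G$ is a family $\{\lambda^u\}_{u\in G^0}$ of positive regular Borel measures $\lambda^u$ on $G^u=r^{-1}(u)$ such that (i) the support of $\lambda^u$ is $G^u$; (ii) for each $g\in C_c(G)$ the function $u\mapsto\int_{G^u}g\,d\lambda^u$ is in $C_c(G^0)$; (iii) $\int_{G^{s(x)}}f(xz)\,d\lambda^{s(x)}(z)=\int_{G^{r(x)}}f(y)\,d\lambda^{r(x)}(y)$ for all $x\in G$, $f\in C_c(G)$. It is continuous if for every chart $(U,\phi)$ of $(G,r)$ and every $u\in r(U)$ the image of $\lambda^u|_{U\cap G^u}$ in $\mathbb R^k$ under $\phi$ is equivalent to Lebesgue measure restricted to $W^u=\{w:(u,w)\in\phi(U)\}$, with Radon-Nikodym derivatives with respect to it that are given by a continuous function of $(u,w)\in\phi(U)$. Theorem 3.3. Every continuous family groupoid $G$ admits a continuous left Haar system. -/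

import Mathlib

open Set Filter Topology MeasureTheory
open scoped ContDiff NNReal ENNReal

namespace CFGpd

/-- The model space `ℝ^k`. -/
abbrev Euc (k : ℕ) : Type := EuclideanSpace ℝ (Fin k)

/-! ### The `C^{0,∞}` maps and the pseudogroup of local isomorphisms -/

section Smooth

variable {Y : Type*} [TopologicalSpace Y] {k l : ℕ}

/-- `y ↦ (h y)|_V` is a continuous map from `U` into the smooth maps on the open set `V`, these
carrying the topology of uniform convergence on compact subsets of `V` of all derivatives.
(Only the values of `h y` on `V` matter, for `y ∈ U`.) -/
def ContinuousIntoSmooth (U : Set Y) (V : Set (Euc k)) (h : Y → Euc k → Euc l) : Prop :=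
  (∀ y ∈ U, ContDiffOn ℝ ∞ (h y) V) ∧
    ∀ y₀ ∈ U, ∀ n : ℕ, ∀ K : Set (Euc k), K ⊆ V → IsCompact K →
      TendstoUniformlyOn (fun y => iteratedFDeriv ℝ n (h y)) (iteratedFDeriv ℝ n (h y₀))
        (𝓝[U] y₀) K

/-- `f` restricts to a map of class `C^{0,∞}` from `A₁` to `A₂`, for open subsets `A₁`, `A₂` of
`Y × ℝ^k`: a continuous map `(y, w) ↦ (y, f^y w)` such that `y ↦ f^y` is continuous into the smooth
maps on every box whose image lies in a box. -/
structure IsC0Inf (A₁ A₂ : Set (Y × Euc k)) (f : Y × Euc k → Y × Euc k) : Prop where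
  continuousOn : ContinuousOn f A₁
  mapsTo : MapsTo f A₁ A₂
  fst_eq : ∀ a ∈ A₁, (f a).1 = a.1
  smooth : ∀ (U₁ U₂ : Set Y) (V₁ V₂ : Set (Euc k)), IsOpen U₁ → IsOpen U₂ → IsOpen V₁ →
    IsOpen V₂ → U₁ ×ˢ V₁ ⊆ A₁ → U₂ ×ˢ V₂ ⊆ A₂ → MapsTo f (U₁ ×ˢ V₁) (U₂ ×ˢ V₂) →
    ContinuousIntoSmooth U₁ V₁ (fun y w => (f (y, w)).2)

/-- A homeomorphism between open subsets of `Y × ℝ^k` which is of class `C^{0,∞}` together with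
its inverse. -/
def IsDiff0 (e : OpenPartialHomeomorph (Y × Euc k) (Y × Euc k)) : Prop :=
  IsC0Inf e.source e.target e ∧ IsC0Inf e.target e.source e.symm

end Smooth

/-! ### Continuous families of manifolds -/

section Family

variable {X Y : Type*} [TopologicalSpace X] [TopologicalSpace Y]

/-- `(X, p)` is a fiber space over `Y`: the spaces are locally compact Hausdorff and `p` is a
continuous open surjection. -/
structure IsFiberSpace (p : X → Y) : Prop where
  t2_total : T2Space X
  locallyCompact_total : LocallyCompactSpace X
  t2_base : T2Space Y
  locallyCompact_base : LocallyCompactSpace Y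
  continuous : Continuous p
  isOpenMap : IsOpenMap p
  surjective : Function.Surjective p

/-- A continuous family of `k`-dimensional manifolds `p⁻¹(y)`, `y ∈ Y`, given by an atlas (not
necessarily a maximal one). A chart is a homeomorphism `φ` from an open subset `φ.source` of `X`
onto an open subset `φ.target` of `Y × ℝ^k`. -/
structure ContinuousFamily (p : X → Y) (k : ℕ) where
  isFiberSpace : IsFiberSpace p
  atlas : Set (OpenPartialHomeomorph X (Y × Euc k))
  cover : ∀ x : X, ∃ φ ∈ atlas, x ∈ φ.source
  fst_eq : ∀ φ ∈ atlas, ∀ x ∈ φ.source, (φ x).1 = p x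
  compatible : ∀ φ ∈ atlas, ∀ ψ ∈ atlas, IsDiff0 (φ.symm.trans ψ)

/-- The charts of a continuous family: the elements of the maximal atlas. -/
def ContinuousFamily.charts {p : X → Y} {k : ℕ} (F : ContinuousFamily p k) :
    Set (OpenPartialHomeomorph X (Y × Euc k)) :=
  {φ | (∀ x ∈ φ.source, (φ x).1 = p x) ∧ ∀ ψ ∈ F.atlas, IsDiff0 (φ.symm.trans ψ)}

/-- The chart `φ` is of product form `U ∼ p(U) × W`. -/
def IsProductChart (p : X → Y) {k : ℕ} (φ : OpenPartialHomeomorph X (Y × Euc k))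
    (W : Set (Euc k)) : Prop :=
  IsOpen W ∧ φ.target = (p '' φ.source) ×ˢ W

variable {X₁ X₂ Y₁ Y₂ : Type*} [TopologicalSpace X₁] [TopologicalSpace X₂]
  [TopologicalSpace Y₁] [TopologicalSpace Y₂]

/-- `f : X₁ → X₂` is a morphism of continuous families with respect to `q : Y₁ → Y₂`: it is
continuous and fiber preserving, and in suitable product charts around any point `x` and any
product chart around `f x` it has the form `(y, w) ↦ (q y, f^y w)` with `y ↦ f^y` continuous into
the smooth maps. -/
structure IsMorphism {p₁ : X₁ → Y₁} {p₂ : X₂ → Y₂} {k₁ k₂ : ℕ} (F₁ : ContinuousFamily p₁ k₁)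
    (F₂ : ContinuousFamily p₂ k₂) (q : Y₁ → Y₂) (f : X₁ → X₂) : Prop where
  continuous_base : Continuous q
  continuous : Continuous f
  fiber_preserving : ∀ x, p₂ (f x) = q (p₁ x)
  smooth : ∀ x : X₁, ∀ φ₂ ∈ F₂.charts, ∀ W₂ : Set (Euc k₂), IsProductChart p₂ φ₂ W₂ →
    f x ∈ φ₂.source →
    ∃ φ₁ ∈ F₁.charts, ∃ W₁ : Set (Euc k₁), IsProductChart p₁ φ₁ W₁ ∧ x ∈ φ₁.source ∧
      MapsTo f φ₁.source φ₂.source ∧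
      ContinuousIntoSmooth (p₁ '' φ₁.source) W₁ (fun y w => (φ₂ (f (φ₁.symm (y, w)))).2)

/-- `f` is an isomorphism of continuous families over the same base (and the identity of it). -/
def IsIsomorphism {p₁ : X₁ → Y} {p₂ : X₂ → Y} {k₁ k₂ : ℕ} (F₁ : ContinuousFamily p₁ k₁)
    (F₂ : ContinuousFamily p₂ k₂) (f : X₁ → X₂) : Prop :=
  ∃ g : X₂ → X₁, Function.LeftInverse g f ∧ Function.RightInverse g f ∧
    IsMorphism F₁ F₂ id f ∧ IsMorphism F₂ F₁ id g

end Family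

/-! ### Pull-backs of continuous families -/

section Pullback

variable {X Y Z : Type*} [TopologicalSpace X] [TopologicalSpace Y] [TopologicalSpace Z]

theorem isFiberSpace_pullback [T2Space Z] [LocallyCompactSpace Z] {p : X → Y}
    (hp : IsFiberSpace p) {t : Z → Y} (ht : Continuous t) :
    IsFiberSpace (Function.Pullback.fst : Function.Pullback t p → Z) := by
  have := hp.t2_total
  have := hp.locallyCompact_total
  have := hp.t2_base
  have hcl : IsClosed {a : Z × X | t a.1 = p a.2} :=
    isClosed_eq (ht.comp continuous_fst) (hp.continuous.comp continuous_snd)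
  refine ⟨inferInstanceAs (T2Space {a : Z × X // t a.1 = p a.2}),
    hcl.locallyCompactSpace, inferInstance, inferInstance,
    continuous_fst.comp continuous_subtype_val, ?_, ?_⟩
  · rw [isOpenMap_iff_nhds_le]
    rintro ⟨⟨z, x⟩, hzx⟩ s hs
    rw [mem_map, nhds_subtype_eq_comap, mem_comap] at hs
    obtain ⟨w, hw, hws⟩ := hs
    obtain ⟨N, hN, O, hO, hNO⟩ := mem_nhds_prod_iff.1 hw
    have h1 : p '' O ∈ 𝓝 (t z) := by
      have : t z = p x := hzx
      rw [this]
      exact hp.isOpenMap.image_mem_nhds hO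
    filter_upwards [hN, ht.continuousAt h1] with z' hz' hz''
    obtain ⟨x', hx', hxz⟩ := hz''
    exact hws (a := (⟨(z', x'), hxz.symm⟩ : Function.Pullback t p)) (hNO ⟨hz', hx'⟩)
  · intro z
    obtain ⟨x, hx⟩ := hp.surjective (t z)
    exact ⟨⟨(z, x), hx.symm⟩, rfl⟩

open Classical in
/-- The chart `(z, x) ↦ (z, h x)` on the pull-back which is induced by a chart
`x ↦ (p x, h x)`. -/
noncomputable def pullbackChart {k : ℕ} {p : X → Y} (hp : IsFiberSpace p) {t : Z → Y}
    (ht : Continuous t) (φ : OpenPartialHomeomorph X (Y × Euc k))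
    (hφ : ∀ x ∈ φ.source, (φ x).1 = p x) :
    OpenPartialHomeomorph (Function.Pullback t p) (Z × Euc k) where
  toFun a := (a.1.1, (φ a.1.2).2)
  invFun b :=
    if h : (t b.1, b.2) ∈ φ.target then
      ⟨(b.1, φ.symm (t b.1, b.2)), by
        have h1 := hφ _ (φ.map_target h)
        rw [φ.right_inv h] at h1
        exact h1⟩
    else ⟨(b.1, Function.surjInv hp.surjective (t b.1)),
      (Function.surjInv_eq hp.surjective (t b.1)).symm⟩
  source := {a | a.1.2 ∈ φ.source}
  target := {b | (t b.1, b.2) ∈ φ.target}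
  map_source' := by
    rintro ⟨⟨z, x⟩, h⟩ (hx : x ∈ φ.source)
    have h1 : (t z, (φ x).2) = φ x := Prod.ext (h.trans (hφ x hx).symm) rfl
    change (t z, (φ x).2) ∈ φ.target
    rw [h1]
    exact φ.map_source hx
  map_target' := by
    rintro ⟨z, w⟩ (h : (t z, w) ∈ φ.target)
    simp only [h, dite_true, mem_ofPred_eq]
    exact φ.map_target h
  left_inv' := by
    rintro ⟨⟨z, x⟩, h⟩ (hx : x ∈ φ.source)
    have h1 : (t z, (φ x).2) = φ x := Prod.ext (h.trans (hφ x hx).symm) rfl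
    have h2 : (t z, (φ x).2) ∈ φ.target := h1 ▸ φ.map_source hx
    simp only [h2, dite_true]
    apply Subtype.ext
    simp only [h1, φ.left_inv hx]
  right_inv' := by
    rintro ⟨z, w⟩ (h : (t z, w) ∈ φ.target)
    simp only [h, dite_true, φ.right_inv h]
  open_source := φ.open_source.preimage (continuous_snd.comp continuous_subtype_val)
  open_target := φ.open_target.preimage
    ((ht.comp continuous_fst).prodMk continuous_snd)
  continuousOn_toFun := by
    refine (continuous_fst.comp continuous_subtype_val).continuousOn.prodMk ?_
    exact continuous_snd.comp_continuousOn (φ.continuousOn.comp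
      (continuous_snd.comp continuous_subtype_val).continuousOn fun a ha => ha)
  continuousOn_invFun := by
    refine Topology.IsInducing.subtypeVal.continuousOn_iff.2 ?_
    have h1 : ContinuousOn (fun b : Z × Euc k => (b.1, φ.symm (t b.1, b.2)))
        {b | (t b.1, b.2) ∈ φ.target} :=
      continuous_fst.continuousOn.prodMk (φ.symm.continuousOn.comp
        ((ht.comp continuous_fst).prodMk continuous_snd).continuousOn fun a ha => ha)
    refine h1.congr ?_
    rintro ⟨z, w⟩ (h : (t z, w) ∈ φ.target)
    simp only [Function.comp_apply, h, dite_true]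

/-- Around every point, a map of class `C^{0,∞}` is continuous into the smooth maps on a box. -/
theorem IsC0Inf.exists_box {k : ℕ} {A₁ A₂ : Set (Y × Euc k)} (hA₁ : IsOpen A₁) (hA₂ : IsOpen A₂)
    {f : Y × Euc k → Y × Euc k} (hf : IsC0Inf A₁ A₂ f) {y : Y} {v : Euc k} (h : (y, v) ∈ A₁) :
    ∃ (U : Set Y) (V : Set (Euc k)), IsOpen U ∧ IsOpen V ∧ y ∈ U ∧ v ∈ V ∧
      ContinuousIntoSmooth U V (fun y w => (f (y, w)).2) := by
  obtain ⟨U₂, V₂, hU₂, hV₂, hy₂, hv₂, h₂⟩ :=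
    isOpen_prod_iff.1 hA₂ (f (y, v)).1 (f (y, v)).2 (hf.mapsTo h)
  have hop : IsOpen (A₁ ∩ f ⁻¹' (U₂ ×ˢ V₂)) :=
    hf.continuousOn.isOpen_inter_preimage hA₁ (hU₂.prod hV₂)
  obtain ⟨U₁, V₁, hU₁, hV₁, hy₁, hv₁, h₁⟩ := isOpen_prod_iff.1 hop y v ⟨h, hy₂, hv₂⟩
  exact ⟨U₁, V₁, hU₁, hV₁, hy₁, hv₁, hf.smooth U₁ U₂ V₁ V₂ hU₁ hU₂ hV₁ hV₂
    (fun a ha => (h₁ ha).1) h₂ (fun a ha => (h₁ ha).2)⟩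

/-- Local maps of class `C^{0,∞}` pull back along continuous maps of the base. -/
theorem isC0Inf_pullback {k : ℕ} {t : Z → Y} (ht : Continuous t) {A₁ A₂ : Set (Y × Euc k)}
    (hA₁ : IsOpen A₁) (hA₂ : IsOpen A₂) {f : Y × Euc k → Y × Euc k} (hf : IsC0Inf A₁ A₂ f)
    {B₁ B₂ : Set (Z × Euc k)} {g : Z × Euc k → Z × Euc k}
    (hB₁ : ∀ b, b ∈ B₁ ↔ (t b.1, b.2) ∈ A₁) (hB₂ : ∀ b, b ∈ B₂ ↔ (t b.1, b.2) ∈ A₂)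
    (hg : ∀ b ∈ B₁, g b = (b.1, (f (t b.1, b.2)).2)) : IsC0Inf B₁ B₂ g := by
  have htc : Continuous fun b : Z × Euc k => (t b.1, b.2) :=
    (ht.comp continuous_fst).prodMk continuous_snd
  refine ⟨?_, ?_, fun b hb => by rw [hg b hb], ?_⟩
  · refine ContinuousOn.congr (f := fun b : Z × Euc k => (b.1, (f (t b.1, b.2)).2)) ?_ hg
    exact continuous_fst.continuousOn.prodMk (continuous_snd.comp_continuousOn
      (hf.continuousOn.comp htc.continuousOn fun b hb => (hB₁ b).1 hb))
  · intro b hb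
    have h1 := hf.mapsTo ((hB₁ b).1 hb)
    have h2 := hf.fst_eq _ ((hB₁ b).1 hb)
    rw [hg b hb, hB₂]
    have h3 : (t b.1, (f (t b.1, b.2)).2) = f (t b.1, b.2) := Prod.ext h2.symm rfl
    simpa only [h3] using h1
  · intro U₁ U₂ V₁ V₂ hU₁ hU₂ hV₁ hV₂ h₁ h₂ hm
    have hev : ∀ z ∈ U₁, ∀ v ∈ V₁,
        (fun w => (g (z, w)).2) =ᶠ[𝓝 v] fun w => (f (t z, w)).2 := by
      intro z hz v hv
      filter_upwards [hV₁.mem_nhds hv] with w hw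
      rw [hg _ (h₁ ⟨hz, hw⟩)]
    refine ⟨fun z hz v hv => ?_, fun z₀ hz₀ n K hK hKc => ?_⟩
    · obtain ⟨U, V, hU, hV, hy, hvV, hs⟩ := hf.exists_box hA₁ hA₂ ((hB₁ (z, v)).1 (h₁ ⟨hz, hv⟩))
      exact (((hs.1 _ hy).contDiffAt (hV.mem_nhds hvV)).congr_of_eventuallyEq
        (hev z hz v hv)).contDiffWithinAt
    · rw [← tendstoLocallyUniformlyOn_iff_tendstoUniformlyOn_of_compact hKc]
      intro u hu v hv
      obtain ⟨U, V, hU, hV, hy, hvV, hs⟩ :=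
        hf.exists_box hA₁ hA₂ ((hB₁ (z₀, v)).1 (h₁ ⟨hz₀, hK hv⟩))
      obtain ⟨C, hC, hCV, hCc⟩ := local_compact_nhds
        ((hV.inter hV₁).mem_nhds ⟨hvV, hK hv⟩)
      refine ⟨C, mem_nhdsWithin_of_mem_nhds hC, ?_⟩
      have h3 := hs.2 (t z₀) hy n C (fun x hx => (hCV hx).1) hCc u hu
      have h4 : Tendsto t (𝓝[U₁] z₀) (𝓝[U] (t z₀)) := by
        rw [hU.nhdsWithin_eq hy]
        exact ht.continuousAt.tendsto.mono_left nhdsWithin_le_nhds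
      filter_upwards [h4.eventually h3, self_mem_nhdsWithin] with z hz hzU x hx
      have h5 := hz x hx
      rw [((hev z hzU x (hCV hx).2).iteratedFDeriv ℝ n).eq_of_nhds,
        ((hev z₀ hz₀ x (hCV hx).2).iteratedFDeriv ℝ n).eq_of_nhds]
      exact h5

theorem isC0Inf_pullbackChart {k : ℕ} {p : X → Y} (hp : IsFiberSpace p) {t : Z → Y}
    (ht : Continuous t) {φ ψ : OpenPartialHomeomorph X (Y × Euc k)}
    (hφ : ∀ x ∈ φ.source, (φ x).1 = p x) (hψ : ∀ x ∈ ψ.source, (ψ x).1 = p x)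
    (h : IsC0Inf (φ.symm.trans ψ).source (φ.symm.trans ψ).target (φ.symm.trans ψ)) :
    IsC0Inf ((pullbackChart hp ht φ hφ).symm.trans (pullbackChart hp ht ψ hψ)).source
      ((pullbackChart hp ht φ hφ).symm.trans (pullbackChart hp ht ψ hψ)).target
      ((pullbackChart hp ht φ hφ).symm.trans (pullbackChart hp ht ψ hψ)) := by
  have key : ∀ (χ : OpenPartialHomeomorph X (Y × Euc k))
      (hχ : ∀ x ∈ χ.source, (χ x).1 = p x) (b : Z × Euc k), (t b.1, b.2) ∈ χ.target →
      ((pullbackChart hp ht χ hχ).symm b).1 = (b.1, χ.symm (t b.1, b.2)) := by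
    intro χ hχ b hb
    change ((pullbackChart hp ht χ hχ).invFun b).1 = _
    simp only [pullbackChart, hb, dite_true]
  have key2 : ∀ (χ χ₂ : OpenPartialHomeomorph X (Y × Euc k))
      (hχ : ∀ x ∈ χ.source, (χ x).1 = p x) (hχ₂ : ∀ x ∈ χ₂.source, (χ₂ x).1 = p x)
      (b : Z × Euc k),
      b ∈ ((pullbackChart hp ht χ hχ).symm.trans (pullbackChart hp ht χ₂ hχ₂)).source ↔
        (t b.1, b.2) ∈ (χ.symm.trans χ₂).source := by
    intro χ χ₂ hχ hχ₂ b
    rw [OpenPartialHomeomorph.trans_source, OpenPartialHomeomorph.trans_source]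
    change (t b.1, b.2) ∈ χ.target ∧ ((pullbackChart hp ht χ hχ).symm b).1.2 ∈ χ₂.source ↔
      (t b.1, b.2) ∈ χ.target ∧ χ.symm (t b.1, b.2) ∈ χ₂.source
    refine and_congr_right fun hb => ?_
    rw [key χ hχ b hb]
  refine isC0Inf_pullback ht (φ.symm.trans ψ).open_source (φ.symm.trans ψ).open_target h
    (key2 φ ψ hφ hψ) (fun b => ?_) (fun b hb => ?_)
  · rw [← OpenPartialHomeomorph.symm_source, ← OpenPartialHomeomorph.symm_source,
      OpenPartialHomeomorph.trans_symm_eq_symm_trans_symm,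
      OpenPartialHomeomorph.trans_symm_eq_symm_trans_symm, OpenPartialHomeomorph.symm_symm,
      OpenPartialHomeomorph.symm_symm]
    exact key2 ψ φ hψ hφ b
  · have hb' := ((key2 φ ψ hφ hψ b).1 hb).1
    change (((pullbackChart hp ht φ hφ).symm b).1.1,
      (ψ ((pullbackChart hp ht φ hφ).symm b).1.2).2) = (b.1, (ψ (φ.symm (t b.1, b.2))).2)
    rw [key φ hφ b hb']

theorem isDiff0_pullbackChart {k : ℕ} {p : X → Y} (hp : IsFiberSpace p) {t : Z → Y}
    (ht : Continuous t) {φ ψ : OpenPartialHomeomorph X (Y × Euc k)}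
    (hφ : ∀ x ∈ φ.source, (φ x).1 = p x) (hψ : ∀ x ∈ ψ.source, (ψ x).1 = p x)
    (h : IsDiff0 (φ.symm.trans ψ)) :
    IsDiff0 ((pullbackChart hp ht φ hφ).symm.trans (pullbackChart hp ht ψ hψ)) := by
  refine ⟨isC0Inf_pullbackChart hp ht hφ hψ h.1, ?_⟩
  have h1 : IsC0Inf (ψ.symm.trans φ).source (ψ.symm.trans φ).target (ψ.symm.trans φ) := by
    have h2 := h.2
    rw [← OpenPartialHomeomorph.symm_source, ← OpenPartialHomeomorph.symm_target,
      OpenPartialHomeomorph.trans_symm_eq_symm_trans_symm,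
      OpenPartialHomeomorph.symm_symm] at h2
    exact h2
  have h3 := isC0Inf_pullbackChart hp ht hψ hφ h1
  rw [← OpenPartialHomeomorph.symm_source, ← OpenPartialHomeomorph.symm_target,
    OpenPartialHomeomorph.trans_symm_eq_symm_trans_symm, OpenPartialHomeomorph.symm_symm]
  exact h3

/-- The pull-back of a continuous family `p : X → Y` along a continuous map `t : Z → Y`: its total
space is `{(z, x) | t z = p x}`, with the first projection to `Z`. -/
noncomputable def ContinuousFamily.pullback {p : X → Y} {k : ℕ} (F : ContinuousFamily p k)
    [T2Space Z] [LocallyCompactSpace Z] (t : Z → Y) (ht : Continuous t) :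
    ContinuousFamily (Function.Pullback.fst : Function.Pullback t p → Z) k where
  isFiberSpace := isFiberSpace_pullback F.isFiberSpace ht
  atlas := {χ | ∃ (φ : OpenPartialHomeomorph X (Y × Euc k)) (hφ : φ ∈ F.atlas),
    χ = pullbackChart F.isFiberSpace ht φ (F.fst_eq φ hφ)}
  cover := fun a => by
    obtain ⟨φ, hφ, hx⟩ := F.cover a.1.2
    exact ⟨_, ⟨φ, hφ, rfl⟩, hx⟩
  fst_eq := by
    rintro _ ⟨φ, hφ, rfl⟩ a _
    rfl
  compatible := by
    rintro _ ⟨φ, hφ, rfl⟩ _ ⟨ψ, hψ, rfl⟩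
    exact isDiff0_pullbackChart F.isFiberSpace ht _ _ (F.compatible φ hφ ψ hψ)

end Pullback

/-! ### Groupoids -/

/-- A groupoid, as a set `G` of arrows with a set `comp` of composable pairs, a product and an
inversion. The product is a function on all of `G × G` for convenience; its values at pairs that
are not composable are never used. -/
structure ArrowGroupoid (G : Type*) where
  comp : Set (G × G)
  mul : G → G → G
  inv : G → G
  inv_inv : ∀ a, inv (inv a) = a
  mul_comp : ∀ a b c, (a, b) ∈ comp → (b, c) ∈ comp → (mul a b, c) ∈ comp
  comp_mul : ∀ a b c, (a, b) ∈ comp → (b, c) ∈ comp → (a, mul b c) ∈ comp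
  mul_assoc : ∀ a b c, (a, b) ∈ comp → (b, c) ∈ comp → mul (mul a b) c = mul a (mul b c)
  comp_inv : ∀ b, (b, inv b) ∈ comp
  inv_mul_mul : ∀ a b, (a, b) ∈ comp → mul (inv a) (mul a b) = b
  mul_mul_inv : ∀ a b, (a, b) ∈ comp → mul (mul a b) (inv b) = a

namespace ArrowGroupoid

variable {G : Type*} (L : ArrowGroupoid G)

/-- The unit space `G⁰ = r(G)`. -/
def units : Set G := range fun x => L.mul x (L.inv x)

/-- The range map `r(x) = x x⁻¹`. -/
def rng (x : G) : L.units := ⟨L.mul x (L.inv x), x, rfl⟩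

/-- The source map `s(x) = x⁻¹ x`. -/
def src (x : G) : L.units :=
  ⟨L.mul (L.inv x) x, L.inv x, by simp only [L.inv_inv]⟩

/-- The fiber `G^u = r⁻¹(u)`. -/
abbrev fiber (u : L.units) : Type _ := {x : G // L.rng x = u}

/-- A pair `(a, b)` is composable if and only if `s(a) = r(b)`; so the fibered product of `(G, s)`
and `(G, r)` is the set of composable pairs. -/
theorem mem_comp_iff (a b : G) : (a, b) ∈ L.comp ↔ L.src a = L.rng b := by
  have inv_comp : ∀ a, (L.inv a, a) ∈ L.comp := fun a => by
    have h := L.comp_inv (L.inv a)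
    rwa [L.inv_inv] at h
  rw [Subtype.ext_iff]
  change _ ↔ L.mul (L.inv a) a = L.mul b (L.inv b)
  constructor
  · intro h
    have h1 := L.mul_assoc _ _ _ (inv_comp a) h
    rw [L.inv_mul_mul a b h] at h1
    have h2 := L.mul_mul_inv _ _ (L.mul_comp _ _ _ (inv_comp a) h)
    rw [h1] at h2
    exact h2.symm
  · intro h
    have h1 := L.comp_mul _ _ _ (L.comp_inv a) (inv_comp a)
    have h2 := L.mul_comp _ _ _ (L.comp_inv b) (inv_comp b)
    rw [← h] at h2
    have h3 := L.mul_comp _ _ _ h1 h2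
    rw [← L.mul_assoc _ _ _ (L.comp_inv a) (inv_comp a)] at h3
    have h4 := L.mul_mul_inv _ _ (L.comp_inv a)
    rw [L.inv_inv] at h4
    rwa [h4] at h3

variable [TopologicalSpace G]

/-- The family `lam` of measures, `lam u` on `G^u`, is a left Haar system. -/
structure IsLeftHaarSystem [MeasurableSpace G] (lam : ∀ u : L.units, Measure (L.fiber u)) :
    Prop where
  regular : ∀ u, (lam u).Regular
  support_eq : ∀ u, (lam u).support = univ
  continuous_integral : ∀ g : G → ℂ, Continuous g → HasCompactSupport g →
    Continuous (fun u => ∫ x : L.fiber u, g x ∂lam u) ∧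
      HasCompactSupport (fun u => ∫ x : L.fiber u, g x ∂lam u)
  left_invariant : ∀ (x : G) (f : G → ℂ), Continuous f → HasCompactSupport f →
    ∫ z : L.fiber (L.src x), f (L.mul x z) ∂lam (L.src x) =
      ∫ y : L.fiber (L.rng x), f y ∂lam (L.rng x)

end ArrowGroupoid

/-- A topological groupoid: multiplication (on the set of composable pairs) and inversion are
continuous. It is a locally compact groupoid if the topology of `G` is second countable, locally
compact and Hausdorff. -/
structure TopGroupoid (G : Type*) [TopologicalSpace G] extends ArrowGroupoid G where
  continuousOn_mul : ContinuousOn (fun a : G × G => mul a.1 a.2) comp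
  continuous_inv : Continuous inv

/-- A continuous family groupoid with fibers of dimension `k`, on a locally compact Hausdorff
space `G`. The set of composable pairs is a continuous family over `G`, with the first projection,
as the pull-back of `(G, r)` along `s`. -/
structure ContinuousFamilyGroupoid (G : Type*) [TopologicalSpace G] [T2Space G]
    [LocallyCompactSpace G] (k : ℕ) extends TopGroupoid G where
  rngFamily : ContinuousFamily toArrowGroupoid.rng k
  srcFamily : ContinuousFamily toArrowGroupoid.src k
  isIsomorphism_inv : IsIsomorphism srcFamily rngFamily inv
  isMorphism_mul : IsMorphism
    (rngFamily.pullback toArrowGroupoid.src srcFamily.isFiberSpace.continuous) rngFamily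
    toArrowGroupoid.rng (fun a => mul a.1.1 a.1.2)

namespace ContinuousFamilyGroupoid

variable {G : Type*} [TopologicalSpace G] [T2Space G] [LocallyCompactSpace G] {k : ℕ}
  [MeasurableSpace G] (A : ContinuousFamilyGroupoid G k)

/-- The image on `ℝ^k` of a measure `μ` on `G^u` under the restriction `φ^u` of a chart `φ`
of `(G, r)` to its domain in `G^u`. -/
noncomputable def chartMeasure (φ : OpenPartialHomeomorph G (A.units × Euc k)) (u : A.units)
    (μ : Measure (A.fiber u)) : Measure (Euc k) :=
  (μ.restrict {x | (x : G) ∈ φ.source}).map (fun x : A.fiber u => (φ (x : G)).2)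

/-- Lebesgue measure on the image `W^u` of `φ^u` in `ℝ^k`. -/
noncomputable def chartLebesgue (φ : OpenPartialHomeomorph G (A.units × Euc k)) (u : A.units) :
    Measure (Euc k) :=
  volume.restrict {w | (u, w) ∈ φ.target}

/-- A left Haar system is continuous: in every chart `φ` of `(G, r)`, the measure `lam u` is
equivalent to Lebesgue measure, with a density `(u, w) ↦ ρ (u, w)` which is continuous on
the image of the chart. -/
structure IsContinuousLeftHaarSystem (lam : ∀ u : A.units, Measure (A.fiber u)) : Prop
    extends A.IsLeftHaarSystem lam where
  absolutelyContinuous : ∀ φ ∈ A.rngFamily.charts, ∀ u ∈ A.rng '' φ.source,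
    A.chartMeasure φ u (lam u) ≪ A.chartLebesgue φ u ∧
      A.chartLebesgue φ u ≪ A.chartMeasure φ u (lam u)
  continuous_density : ∀ φ ∈ A.rngFamily.charts, ∃ ρ : A.units × Euc k → ℝ≥0,
    ContinuousOn ρ φ.target ∧ ∀ u ∈ A.rng '' φ.source,
      A.chartMeasure φ u (lam u) =
        (A.chartLebesgue φ u).withDensity (fun w => (ρ (u, w) : ℝ≥0∞))

end ContinuousFamilyGroupoid

end CFGpd

/-! ### Fiberwise C¹ maps depending continuously on a parameter -/

namespace CFGpd

/-! A Haar system arises by integrating a positive continuous density along the fibers of `r` that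
is invariant under the left translations `G^{s(g)} → G^{r(g)}`. Such a density is determined by its
values at the units, because translation by `x⁻¹` carries `x` to the unit `s(x)`; and at the units
it can be prescribed freely. A partition of unity `f_i` on `G⁰` mixes the Lebesgue densities of the
atlas charts, which gives at `x`, in a chart `φ`, the sum of `f_i(s(x))` times the absolute Jacobian
at `x` of translation by `x⁻¹`, read in `φ` and the `i`-th chart (`exists_isInvariantDensity`).
Invariance is the chain rule `jac_mul` together with `(gz)⁻¹g = z⁻¹`; positivity holds because
translations are invertible. Continuity is where multiplication being a morphism enters: the
fiberwise derivative of left translation is jointly continuous in the translating element and the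
point (`c01At_translate`). Only first derivatives matter, so `C01At` retains just these, in a form
stable under composition and change of parameter space.

In each chart the density times Lebesgue measure is a local measure, and the change of variables
formula (`localMeasure_mul_left`) matches local measures under translation. A unit as translating
element gives agreement on chart overlaps, hence a glued measure; a general element gives left
invariance. The measures are built on `G`, concentrated on one fiber, and only then moved to the
fiber.

The other properties are local. Positivity and continuity of the density give equivalence with
Lebesgue measure, full support and local finiteness. Continuity of `u ↦ ∫ g dλ^u` reduces, by a
partition of unity on the support of `g`, to one chart, where it concerns a parameter integral over
`ℝ^k` with a continuous compactly supported integrand. -/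

/-- Near `(z, v)` the functions `f z` are differentiable, and both `f` and its derivative in the
second variable are continuous at `(z, v)`. -/
structure C01At {Z E F : Type*} [TopologicalSpace Z] [NormedAddCommGroup E] [NormedSpace ℝ E]
    [NormedAddCommGroup F] [NormedSpace ℝ F] (f : Z → E → F) (z : Z) (v : E) : Prop where
  continuousAt : ContinuousAt (fun q : Z × E => f q.1 q.2) (z, v)
  differentiable : ∀ᶠ q : Z × E in 𝓝 (z, v), DifferentiableAt ℝ (f q.1) q.2
  continuousAt_fderiv : ContinuousAt (fun q : Z × E => fderiv ℝ (f q.1) q.2) (z, v)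

namespace C01At

variable {Z Z' E F H : Type*} [TopologicalSpace Z] [TopologicalSpace Z']
  [NormedAddCommGroup E] [NormedSpace ℝ E] [NormedAddCommGroup F] [NormedSpace ℝ F]
  [NormedAddCommGroup H] [NormedSpace ℝ H]

theorem differentiableAt {f : Z → E → F} {z : Z} {v : E} (hf : C01At f z v) :
    DifferentiableAt ℝ (f z) v :=
  hf.differentiable.self_of_nhds

theorem congr {f g : Z → E → F} {z : Z} {v : E} (hf : C01At f z v)
    (h : ∀ᶠ q : Z × E in 𝓝 (z, v), f q.1 q.2 = g q.1 q.2) : C01At g z v := by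
  -- Agreement near `(z, v)` in the product gives, at each nearby pair, agreement of germs in the
  -- second variable, hence of derivatives.
  have h2 : ∀ᶠ q : Z × E in 𝓝 (z, v), f q.1 =ᶠ[𝓝 q.2] g q.1 :=
    h.eventually_nhds.mono fun q hq => (Continuous.prodMk_right q.1).continuousAt.eventually hq
  refine ⟨hf.continuousAt.congr h, ?_, hf.continuousAt_fderiv.congr ?_⟩
  · filter_upwards [hf.differentiable, h2] with q h3 h4
    exact h3.congr_of_eventuallyEq h4.symm
  · exact h2.mono fun q hq => hq.fderiv_eq

theorem comp {g : Z → F → H} {f : Z → E → F} {z : Z} {v : E} (hg : C01At g z (f z v))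
    (hf : C01At f z v) : C01At (fun z w => g z (f z w)) z v := by
  have hc : ContinuousAt (fun q : Z × E => (q.1, f q.1 q.2)) (z, v) :=
    continuousAt_fst.prodMk hf.continuousAt
  have hd := hc.eventually hg.differentiable
  refine ⟨ContinuousAt.comp_of_eq (g := fun q : Z × F => g q.1 q.2) hg.continuousAt hc rfl, ?_, ?_⟩
  · filter_upwards [hd, hf.differentiable] with q h1 h2
    exact DifferentiableAt.comp (g := g q.1) (f := f q.1) q.2 h1 h2
  · have h3 : ContinuousAt (fun q : Z × E =>
        (fderiv ℝ (g q.1) (f q.1 q.2)).comp (fderiv ℝ (f q.1) q.2)) (z, v) :=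
      (ContinuousAt.comp_of_eq (g := fun q : Z × F => fderiv ℝ (g q.1) q.2)
        hg.continuousAt_fderiv hc rfl).clm_comp
        hf.continuousAt_fderiv
    refine h3.congr ?_
    filter_upwards [hd, hf.differentiable] with q h1 h2
    exact (fderiv_comp (g := g q.1) (f := f q.1) q.2 h1 h2).symm

theorem base {f : Z' → E → F} {t : Z → Z'} {z : Z} {v : E} (ht : ContinuousAt t z)
    (hf : C01At f (t z) v) : C01At (fun z => f (t z)) z v := by
  have hc : ContinuousAt (fun q : Z × E => (t q.1, q.2)) (z, v) :=
    (ContinuousAt.comp (f := Prod.fst) (x := (z, v)) ht continuousAt_fst).prodMk continuousAt_snd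
  exact ⟨ContinuousAt.comp_of_eq (g := fun q : Z' × E => f q.1 q.2) hf.continuousAt hc rfl,
    hc.eventually hf.differentiable,
    ContinuousAt.comp_of_eq (g := fun q : Z' × E => fderiv ℝ (f q.1) q.2) hf.continuousAt_fderiv hc rfl⟩

end C01At

section Smooth

variable {Y : Type*} [TopologicalSpace Y] {k l : ℕ}

/-- The first iterated derivative is the derivative with its argument packed into a one-entry tuple;
evaluation on constant tuples compares the norms. -/
theorem norm_fderiv_sub_le {E F : Type*} [NormedAddCommGroup E] [NormedSpace ℝ E]
    [NormedAddCommGroup F] [NormedSpace ℝ F] (f g : E → F) (x y : E) :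
    ‖fderiv ℝ f x - fderiv ℝ g y‖ ≤ ‖iteratedFDeriv ℝ 1 f x - iteratedFDeriv ℝ 1 g y‖ := by
  refine ContinuousLinearMap.opNorm_le_bound _ (norm_nonneg _) fun v => ?_
  have := (iteratedFDeriv ℝ 1 f x - iteratedFDeriv ℝ 1 g y).le_opNorm (fun _ => v)
  simpa [iteratedFDeriv_one_apply] using this

/-- All derivatives of a continuous family of smooth maps are jointly continuous. -/
theorem ContinuousIntoSmooth.continuousAt_iteratedFDeriv {U : Set Y} {V : Set (Euc k)}
    {h : Y → Euc k → Euc l} (hh : ContinuousIntoSmooth U V h) (hU : IsOpen U) (hV : IsOpen V)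
    {y : Y} {v : Euc k} (hy : y ∈ U) (hv : v ∈ V) (n : ℕ) :
    ContinuousAt (fun q : Y × Euc k => iteratedFDeriv ℝ n (h q.1) q.2) (y, v) := by
  -- On a compact neighbourhood the derivatives converge uniformly, and the limit is continuous in
  -- the space variable; each contributes `ε / 2`.
  obtain ⟨C, hC, hCV, hCc⟩ := local_compact_nhds (hV.mem_nhds hv)
  have h1 := hh.2 y hy n C hCV hCc
  rw [hU.nhdsWithin_eq hy] at h1
  have h2 : ContinuousAt (iteratedFDeriv ℝ n (h y)) v :=
    ((hh.1 y hy).contDiffAt (hV.mem_nhds hv)).continuousAt_iteratedFDeriv (by exact_mod_cast le_top)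
  rw [Metric.continuousAt_iff']
  intro ε hε
  rw [Metric.tendstoUniformlyOn_iff] at h1
  have h3 := (Metric.continuousAt_iff'.1 h2) (ε / 2) (half_pos hε)
  rw [nhds_prod_eq]
  filter_upwards [(h1 (ε / 2) (half_pos hε)).prod_mk (h3.and hC)] with q hq
  calc dist (iteratedFDeriv ℝ n (h q.1) q.2) (iteratedFDeriv ℝ n (h y) v)
      ≤ dist (iteratedFDeriv ℝ n (h q.1) q.2) (iteratedFDeriv ℝ n (h y) q.2) +
        dist (iteratedFDeriv ℝ n (h y) q.2) (iteratedFDeriv ℝ n (h y) v) := dist_triangle _ _ _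
    _ < ε / 2 + ε / 2 := by
        refine add_lt_add ?_ hq.2.1
        rw [dist_comm]
        exact hq.1 q.2 hq.2.2
    _ = ε := add_halves ε

theorem ContinuousIntoSmooth.c01At {U : Set Y} {V : Set (Euc k)}
    {h : Y → Euc k → Euc l} (hh : ContinuousIntoSmooth U V h) (hU : IsOpen U) (hV : IsOpen V)
    {y : Y} {v : Euc k} (hy : y ∈ U) (hv : v ∈ V) : C01At h y v := by
  refine ⟨?_, ?_, ?_⟩
  · have h0 := hh.continuousAt_iteratedFDeriv hU hV hy hv 0
    have h1 : Continuous fun M : ContinuousMultilinearMap ℝ (fun _ : Fin 0 => Euc k) (Euc l) =>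
      M 0 := continuous_eval_const _
    simpa [Function.comp_def] using h1.continuousAt.comp h0
  · filter_upwards [(hU.prod hV).mem_nhds (⟨hy, hv⟩ : (y, v) ∈ U ×ˢ V)] with q hq
    exact ((hh.1 q.1 hq.1).contDiffAt (hV.mem_nhds hq.2)).differentiableAt (by simp)
  · have h1 := hh.continuousAt_iteratedFDeriv hU hV hy hv 1
    rw [ContinuousAt, tendsto_iff_norm_sub_tendsto_zero] at h1 ⊢
    exact squeeze_zero (fun _ => norm_nonneg _) (fun q => norm_fderiv_sub_le _ _ _ _) h1

theorem IsC0Inf.c01At {A₁ A₂ : Set (Y × Euc k)} (hA₁ : IsOpen A₁) (hA₂ : IsOpen A₂)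
    {f : Y × Euc k → Y × Euc k} (hf : IsC0Inf A₁ A₂ f) {y : Y} {v : Euc k} (h : (y, v) ∈ A₁) :
    C01At (fun y w => (f (y, w)).2) y v := by
  obtain ⟨U, V, hU, hV, hy, hv, hs⟩ := hf.exists_box hA₁ hA₂ h
  exact hs.c01At hU hV hy hv

theorem IsC0Inf.mono {A₁ A₂ B₁ B₂ : Set (Y × Euc k)} {f : Y × Euc k → Y × Euc k}
    (hf : IsC0Inf A₁ A₂ f) (h₁ : B₁ ⊆ A₁) (h₂ : B₂ ⊆ A₂) (h : MapsTo f B₁ B₂) :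
    IsC0Inf B₁ B₂ f :=
  ⟨hf.continuousOn.mono h₁, h, fun a ha => hf.fst_eq a (h₁ ha),
    fun U₁ U₂ V₁ V₂ a b c d e i => hf.smooth U₁ U₂ V₁ V₂ a b c d (e.trans h₁) (i.trans h₂)⟩

end Smooth

/-! ### Charts and their transition maps -/

namespace ContinuousFamily

variable {X Y : Type*} [TopologicalSpace X] [TopologicalSpace Y] {p : X → Y} {k : ℕ}
  (F : ContinuousFamily p k)

theorem atlas_subset_charts : F.atlas ⊆ F.charts :=
  fun φ hφ => ⟨F.fst_eq φ hφ, F.compatible φ hφ⟩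

variable {F}

theorem apply_eq {φ : OpenPartialHomeomorph X (Y × Euc k)} (hφ : φ ∈ F.charts) {x : X}
    (hx : x ∈ φ.source) : φ x = (p x, (φ x).2) :=
  Prod.ext (hφ.1 x hx) rfl

theorem symm_apply {φ : OpenPartialHomeomorph X (Y × Euc k)} (hφ : φ ∈ F.charts) {x : X}
    (hx : x ∈ φ.source) : φ.symm (p x, (φ x).2) = x := by
  rw [← apply_eq hφ hx, φ.left_inv hx]

theorem mem_target {φ : OpenPartialHomeomorph X (Y × Euc k)} (hφ : φ ∈ F.charts) {x : X}
    (hx : x ∈ φ.source) : (p x, (φ x).2) ∈ φ.target := by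
  rw [← apply_eq hφ hx]
  exact φ.map_source hx

theorem proj_symm {φ : OpenPartialHomeomorph X (Y × Euc k)} (hφ : φ ∈ F.charts) {b : Y × Euc k}
    (hb : b ∈ φ.target) : p (φ.symm b) = b.1 := by
  rw [← hφ.1 _ (φ.map_target hb), φ.right_inv hb]

/-- Needed because the morphism condition tests only charts of product form, which are reached by
shrinking. -/
theorem restr_mem_charts {φ : OpenPartialHomeomorph X (Y × Euc k)} (hφ : φ ∈ F.charts)
    {s : Set X} (hs : IsOpen s) : φ.restrOpen s hs ∈ F.charts := by
  refine ⟨fun x hx => hφ.1 x hx.1, fun ψ hψ => ?_⟩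
  obtain ⟨h1, h2⟩ := hφ.2 ψ hψ
  have e1 : ((φ.restrOpen s hs).symm.trans ψ).source ⊆ (φ.symm.trans ψ).source := by
    intro b hb
    exact ⟨hb.1.1, hb.2⟩
  have e2 : ((φ.restrOpen s hs).symm.trans ψ).target ⊆ (φ.symm.trans ψ).target := by
    intro b hb
    exact ⟨hb.1, hb.2.1⟩
  exact ⟨h1.mono e1 e2 ((φ.restrOpen s hs).symm.trans ψ).mapsTo,
    h2.mono e2 e1 ((φ.restrOpen s hs).symm.trans ψ).symm.mapsTo⟩

/-- A chart restricts to a chart of product form around each of its points. -/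
theorem exists_productChart {φ : OpenPartialHomeomorph X (Y × Euc k)} (hφ : φ ∈ F.charts) {x : X}
    (hx : x ∈ φ.source) : ∃ (s : Set X) (hs : IsOpen s) (W : Set (Euc k)), x ∈ s ∧
      IsProductChart p (φ.restrOpen s hs) W := by
  obtain ⟨N, W, hN, hW, hy, hw, hNW⟩ := isOpen_prod_iff.1 φ.open_target (p x) (φ x).2
    (mem_target hφ hx)
  have ho : IsOpen (φ.source ∩ φ ⁻¹' (N ×ˢ W)) := φ.isOpen_inter_preimage (hN.prod hW)
  refine ⟨_, ho, W, ⟨hx, by rw [mem_preimage, apply_eq hφ hx]; exact ⟨hy, hw⟩⟩, hW, ?_⟩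
  -- Every point of `N` is hit by keeping the fiber coordinate of `x` fixed.
  have h1 : p '' (φ.restrOpen _ ho).source = N := by
    ext y
    constructor
    · rintro ⟨x', ⟨h1, -, h2⟩, rfl⟩
      rw [← hφ.1 _ h1]
      exact h2.1
    · intro hy'
      have h3 : (y, (φ x).2) ∈ φ.target := hNW ⟨hy', hw⟩
      refine ⟨φ.symm (y, (φ x).2), ⟨φ.map_target h3, φ.map_target h3, ?_⟩, proj_symm hφ h3⟩
      rw [mem_preimage, φ.right_inv h3]
      exact ⟨hy', hw⟩
  rw [h1]
  ext b
  constructor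
  · rintro ⟨h2, -, h3⟩
    rwa [mem_preimage, φ.right_inv h2] at h3
  · intro hb
    have h2 := hNW hb
    refine ⟨h2, φ.map_target h2, ?_⟩
    rwa [mem_preimage, φ.right_inv h2]

theorem c01At_of_isC0Inf_trans {φ ψ : OpenPartialHomeomorph X (Y × Euc k)} (hφ : φ ∈ F.charts)
    (h : IsC0Inf (φ.symm.trans ψ).source (φ.symm.trans ψ).target (φ.symm.trans ψ)) {x : X}
    (hx : x ∈ φ.source) (hx' : x ∈ ψ.source) :
    C01At (fun y w => (ψ (φ.symm (y, w))).2) (p x) (φ x).2 :=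
  h.c01At (φ.symm.trans ψ).open_source (φ.symm.trans ψ).open_target
    ⟨mem_target hφ hx, show φ.symm _ ∈ ψ.source by rwa [symm_apply hφ hx]⟩

theorem isC0Inf_symm_trans {φ ψ : OpenPartialHomeomorph X (Y × Euc k)}
    (h : IsDiff0 (φ.symm.trans ψ)) :
    IsC0Inf (ψ.symm.trans φ).source (ψ.symm.trans φ).target (ψ.symm.trans φ) := by
  have h2 := h.2
  rw [← OpenPartialHomeomorph.symm_source, ← OpenPartialHomeomorph.symm_target,
    OpenPartialHomeomorph.trans_symm_eq_symm_trans_symm, OpenPartialHomeomorph.symm_symm] at h2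
  exact h2

/-- The transition maps between charts are fiberwise continuously differentiable. -/
theorem c01At_transition {φ ψ : OpenPartialHomeomorph X (Y × Euc k)} (hφ : φ ∈ F.charts)
    (hψ : ψ ∈ F.charts) {x : X} (hx : x ∈ φ.source) (hx' : x ∈ ψ.source) :
    C01At (fun y w => (ψ (φ.symm (y, w))).2) (p x) (φ x).2 := by
  -- A chart is by definition compared only with atlas charts, so the transition is factored through
  -- an atlas chart around `x`.
  obtain ⟨χ, hχ, hxχ⟩ := F.cover x
  have hχ' := F.atlas_subset_charts hχ
  have h1 := c01At_of_isC0Inf_trans hφ (hφ.2 χ hχ).1 hx hxχ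
  have h2 := c01At_of_isC0Inf_trans hχ' (isC0Inf_symm_trans (hψ.2 χ hχ)) hxχ hx'
  have h3 : (χ (φ.symm (p x, (φ x).2))).2 = (χ x).2 := by rw [symm_apply hφ hx]
  refine (C01At.comp (g := fun y w => (ψ (χ.symm (y, w))).2)
    (f := fun y w => (χ (φ.symm (y, w))).2) (by rw [h3]; exact h2) h1).congr ?_
  have ho := (φ.symm.trans χ).open_source.mem_nhds (x := (p x, (φ x).2))
    ⟨mem_target hφ hx, show φ.symm _ ∈ χ.source by rwa [symm_apply hφ hx]⟩
  filter_upwards [ho] with q hq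
  have h4 := symm_apply hχ' (x := φ.symm q) hq.2
  rw [proj_symm hφ hq.1] at h4
  exact congrArg (fun a => (ψ a).2) h4

end ContinuousFamily

/-! ### Groupoid algebra -/

namespace ArrowGroupoid

variable {G : Type*} (L : ArrowGroupoid G)

theorem rng_inv (a : G) : L.rng (L.inv a) = L.src a :=
  Subtype.ext (by simp only [rng, src, L.inv_inv])

theorem src_inv (a : G) : L.src (L.inv a) = L.rng a :=
  Subtype.ext (by simp only [rng, src, L.inv_inv])

theorem inv_comp (a : G) : (L.inv a, a) ∈ L.comp :=
  (L.mem_comp_iff _ _).2 (L.src_inv a)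

variable {L} in
theorem src_mul {a b : G} (h : (a, b) ∈ L.comp) : L.src (L.mul a b) = L.src b := by
  rw [(L.mem_comp_iff _ _).1 (L.mul_comp _ _ _ h (L.comp_inv b)), rng_inv]

variable {L} in
theorem rng_mul {a b : G} (h : (a, b) ∈ L.comp) : L.rng (L.mul a b) = L.rng a := by
  rw [← (L.mem_comp_iff _ _).1 (L.comp_mul _ _ _ (L.inv_comp a) h), src_inv]

theorem rng_unit (u : L.units) : L.rng u = u := by
  obtain ⟨_, x, rfl⟩ := u
  exact rng_mul (L.comp_inv x)

theorem src_unit (u : L.units) : L.src u = u := by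
  obtain ⟨_, x, rfl⟩ := u
  exact (src_mul (L.comp_inv x)).trans (L.src_inv x)

theorem rng_mul_self (z : G) : L.mul (L.rng z) z = z := by
  have h := L.inv_mul_mul _ _ (L.inv_comp z)
  rw [L.inv_inv, ← L.mul_assoc _ _ _ (L.comp_inv z) (L.inv_comp z)] at h
  exact h

variable {L} in
theorem mul_inv_mul {g y : G} (h : L.rng y = L.rng g) : L.mul g (L.mul (L.inv g) y) = y := by
  have := L.inv_mul_mul (L.inv g) y ((L.mem_comp_iff _ _).2 ((L.src_inv g).trans h.symm))
  rwa [L.inv_inv] at this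

variable {L} in
-- The identity behind invariance of the density: going from `z` to `gz` and back to the unit `s(z)`
-- is the same as going there directly.
theorem inv_mul_mul_left {g z : G} (h : (g, z) ∈ L.comp) :
    L.mul (L.inv (L.mul g z)) g = L.inv z := by
  have h1 := L.inv_mul_mul _ _ (L.mul_comp _ _ _ h (L.comp_inv z))
  rwa [L.mul_mul_inv _ _ h] at h1

end ArrowGroupoid

/-! ### Left translation in charts and its Jacobian -/

namespace ContinuousFamilyGroupoid

open ArrowGroupoid ContinuousFamily

variable {G : Type*} [TopologicalSpace G] [T2Space G] [LocallyCompactSpace G] {k : ℕ}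
  (A : ContinuousFamilyGroupoid G k)

theorem continuous_rng : Continuous A.rng := A.rngFamily.isFiberSpace.continuous

theorem continuous_src : Continuous A.src := A.srcFamily.isFiberSpace.continuous

/-- Left translation by `g` from the fiber over `s(g)` to the fiber over `r(g)`, read in charts. -/
noncomputable def translate (φ ψ : OpenPartialHomeomorph G (A.units × Euc k)) (g : G) (w : Euc k) :
    Euc k :=
  (ψ (A.mul g (φ.symm (A.src g, w)))).2

/-- The pairs `(g, w)` at which left translation is defined in the given charts. -/
def translateDomain (φ ψ : OpenPartialHomeomorph G (A.units × Euc k)) : Set (G × Euc k) :=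
  {q | (A.src q.1, q.2) ∈ φ.target ∧ A.mul q.1 (φ.symm (A.src q.1, q.2)) ∈ ψ.source}

variable {A} {φ ψ χ : OpenPartialHomeomorph G (A.units × Euc k)}

theorem isOpen_translateDomain (hφ : φ ∈ A.rngFamily.charts) : IsOpen (A.translateDomain φ ψ) := by
  have hc : Continuous fun q : G × Euc k => (A.src q.1, q.2) :=
    (A.continuous_src.comp continuous_fst).prodMk continuous_snd
  have hm : ContinuousOn (fun q : G × Euc k => A.mul q.1 (φ.symm (A.src q.1, q.2)))
      ((fun q : G × Euc k => (A.src q.1, q.2)) ⁻¹' φ.target) := by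
    refine A.continuousOn_mul.comp (f := fun q : G × Euc k => (q.1, φ.symm (A.src q.1, q.2)))
      (continuousOn_fst.prodMk (φ.symm.continuousOn.comp hc.continuousOn fun q hq => hq)) ?_
    intro q hq
    exact (A.mem_comp_iff _ _).2 (proj_symm hφ hq).symm
  exact hm.isOpen_inter_preimage (φ.open_target.preimage hc) ψ.open_source

theorem mem_translateDomain (hφ : φ ∈ A.rngFamily.charts) {g z : G} (hgz : A.src g = A.rng z)
    (hz : z ∈ φ.source) (hz' : A.mul g z ∈ ψ.source) :
    (g, (φ z).2) ∈ A.translateDomain φ ψ := by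
  simp only [translateDomain, mem_ofPred_eq, hgz]
  rw [symm_apply hφ hz]
  exact ⟨mem_target hφ hz, hz'⟩

theorem translate_apply (hφ : φ ∈ A.rngFamily.charts) {g z : G} (hgz : A.src g = A.rng z)
    (hz : z ∈ φ.source) : A.translate φ ψ g (φ z).2 = (ψ (A.mul g z)).2 := by
  simp only [translate, hgz]
  rw [symm_apply hφ hz]

/-- Associativity of the product; the intermediate chart cancels against its inverse. -/
theorem translate_translate (hφ : φ ∈ A.rngFamily.charts) (hψ : ψ ∈ A.rngFamily.charts) {h g : G}
    {w : Euc k} (hhg : A.src h = A.rng g) (hw : (g, w) ∈ A.translateDomain φ ψ) :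
    A.translate ψ χ h (A.translate φ ψ g w) = A.translate φ χ (A.mul h g) w := by
  have h1 := proj_symm hφ hw.1
  have hc := (A.mem_comp_iff _ _).2 h1.symm
  have hc' := (A.mem_comp_iff _ _).2 hhg
  have h2 : A.rng (A.mul g (φ.symm (A.src g, w))) = A.src h := (rng_mul hc).trans hhg.symm
  have h3 : ψ.symm (A.src h, (ψ (A.mul g (φ.symm (A.src g, w)))).2) =
      A.mul g (φ.symm (A.src g, w)) := by
    rw [← h2]
    exact symm_apply hψ hw.2
  simp only [translate]
  rw [h3, src_mul hc', A.mul_assoc _ _ _ hc' hc]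

theorem translate_unit (hφ : φ ∈ A.rngFamily.charts) {u : A.units} {w : Euc k}
    (hw : (u, w) ∈ φ.target) : A.translate φ φ u w = w := by
  simp only [translate, A.src_unit]
  have h1 := A.rng_mul_self (φ.symm (u, w))
  rw [proj_symm hφ hw] at h1
  rw [h1, φ.right_inv hw]

theorem pullbackChart_symm_coe {X Y Z : Type*} [TopologicalSpace X] [TopologicalSpace Y]
    [TopologicalSpace Z] {p : X → Y} (hp : IsFiberSpace p) {t : Z → Y} (ht : Continuous t)
    (χ : OpenPartialHomeomorph X (Y × Euc k)) (hχ : ∀ x ∈ χ.source, (χ x).1 = p x)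
    {b : Z × Euc k} (hb : (t b.1, b.2) ∈ χ.target) :
    ((pullbackChart hp ht χ hχ).symm b).1 = (b.1, χ.symm (t b.1, b.2)) := by
  change ((pullbackChart hp ht χ hχ).invFun b).1 = _
  simp only [pullbackChart, hb, dite_true]

/-- Left translation is fiberwise continuously differentiable, also as a function of the
translating element. -/
theorem c01At_translate (hφ : φ ∈ A.rngFamily.charts) (hψ : ψ ∈ A.rngFamily.charts) {g z : G}
    (hgz : A.src g = A.rng z) (hz : z ∈ φ.source) (hz' : A.mul g z ∈ ψ.source) :
    C01At (A.translate φ ψ) g (φ z).2 := by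
  -- The given atlas of the pull-back contains only charts induced by atlas charts, so `φ` is first
  -- replaced by an atlas chart `χ`.
  obtain ⟨χ, hχ, hzχ⟩ := A.rngFamily.cover z
  have hχ' := A.rngFamily.atlas_subset_charts hχ
  obtain ⟨s, hs, W₂, hzs, hW₂⟩ := exists_productChart hψ hz'
  let P := A.rngFamily.pullback A.src A.continuous_src
  let a : Function.Pullback A.src A.rng := ⟨(g, z), hgz⟩
  -- Smoothness of multiplication is known only in some product chart `φ₁` of the composable pairs;
  -- composing with the transition from `π` to `φ₁` brings it to the coordinates `(g, w)`.
  obtain ⟨φ₁, hφ₁, W₁, hW₁, haφ₁, -, hsm⟩ := A.isMorphism_mul.smooth a _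
    (restr_mem_charts hψ hs) W₂ hW₂ ⟨hz', hzs⟩
  let π := pullbackChart A.rngFamily.isFiberSpace A.continuous_src χ (A.rngFamily.fst_eq χ hχ)
  have hπ : π ∈ P.atlas := ⟨χ, hχ, rfl⟩
  have hπ' := P.atlas_subset_charts hπ
  have haπ : a ∈ π.source := hzχ
  have ha₁ := mem_target hφ₁ haφ₁
  rw [hW₁.2] at ha₁
  have h1 := hsm.c01At (P.isFiberSpace.isOpenMap _ φ₁.open_source) hW₁.1 ha₁.1 ha₁.2
  have h2 := c01At_transition hπ' hφ₁ haπ haφ₁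
  have h3 : (φ₁ (π.symm (a.fst, (π a).2))).2 = (φ₁ a).2 := by rw [symm_apply hπ' haπ]
  have h4 : C01At (fun x w => (ψ (A.mul (π.symm (x, w)).1.1 (π.symm (x, w)).1.2)).2) g (χ z).2 := by
    refine (C01At.comp (g := fun x w => (ψ (A.mul (φ₁.symm (x, w)).1.1 (φ₁.symm (x, w)).1.2)).2)
      (f := fun x w => (φ₁ (π.symm (x, w))).2) (by rw [h3]; exact h1) h2).congr ?_
    have ho := (π.symm.trans φ₁).open_source.mem_nhds (x := (g, (π a).2))
      ⟨mem_target hπ' haπ, show π.symm (g, (π a).2) ∈ φ₁.source by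
        rwa [show π.symm (g, (π a).2) = a from symm_apply hπ' haπ]⟩
    filter_upwards [ho] with q hq
    have h4 := symm_apply hφ₁ (x := π.symm q) hq.2
    have h5 : (π.symm q).1.1 = q.1 := proj_symm hπ' hq.1
    change φ₁.symm ((π.symm q).1.1, _) = _ at h4
    rw [h5] at h4
    change (ψ (A.mul (φ₁.symm (q.1, (φ₁ (π.symm q)).2)).1.1
      (φ₁.symm (q.1, (φ₁ (π.symm q)).2)).1.2)).2 = _
    rw [h4]
  have h5 : C01At (A.translate χ ψ) g (χ z).2 := by
    refine h4.congr ?_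
    filter_upwards [π.open_target.mem_nhds (mem_target hπ' haπ)] with q hq
    have h6 : (π.symm (q.1, q.2)).1 = _ := pullbackChart_symm_coe A.rngFamily.isFiberSpace
      A.continuous_src χ (A.rngFamily.fst_eq χ hχ) hq
    rw [h6]
    rfl
  -- Return from `χ` to `φ`: on the fiber over `s(g)` this transition depends on `g` only through
  -- `s(g)`, hence is pulled back along `A.src`.
  have h6 := C01At.base (f := fun y w => (χ (φ.symm (y, w))).2) (t := A.src) (z := g)
    A.continuous_src.continuousAt (by rw [hgz]; exact c01At_transition hφ hχ' hz hzχ)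
  have h7 : (χ (φ.symm (A.src g, (φ z).2))).2 = (χ z).2 := by rw [hgz, symm_apply hφ hz]
  refine (C01At.comp (g := A.translate χ ψ) (by rw [h7]; exact h5) h6).congr ?_
  have hc : Continuous fun q : G × Euc k => (A.src q.1, q.2) :=
    (A.continuous_src.comp continuous_fst).prodMk continuous_snd
  have ho := hc.continuousAt (x := (g, (φ z).2)) ((φ.symm.trans χ).open_source.mem_nhds
    (x := (A.src g, (φ z).2)) ⟨by rw [hgz]; exact mem_target hφ hz,
      show φ.symm _ ∈ χ.source by rwa [hgz, symm_apply hφ hz]⟩)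
  filter_upwards [ho] with q hq
  have h8 := symm_apply hχ' (x := φ.symm (A.src q.1, q.2)) hq.2
  rw [proj_symm hφ hq.1] at h8
  simp only [translate]
  rw [h8]

variable (A) in
/-- The absolute value of the Jacobian determinant of left translation in charts. -/
noncomputable def jac (φ ψ : OpenPartialHomeomorph G (A.units × Euc k)) (g : G) (w : Euc k) :
    ℝ≥0 :=
  ‖(fderiv ℝ (A.translate φ ψ g) w).det‖₊

/-- The chain rule and multiplicativity of the determinant; openness of the translation domain makes
the composition formula hold on a neighbourhood. -/
theorem jac_mul (hφ : φ ∈ A.rngFamily.charts) (hψ : ψ ∈ A.rngFamily.charts)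
    (hχ : χ ∈ A.rngFamily.charts) {h g z : G} (hgz : A.src g = A.rng z) (hhg : A.src h = A.rng g)
    (hz : z ∈ φ.source) (hz' : A.mul g z ∈ ψ.source) (hz'' : A.mul h (A.mul g z) ∈ χ.source) :
    A.jac φ χ (A.mul h g) (φ z).2 = A.jac ψ χ h (ψ (A.mul g z)).2 * A.jac φ ψ g (φ z).2 := by
  have hc := (A.mem_comp_iff _ _).2 hgz
  have h1 : A.translate φ χ (A.mul h g) =ᶠ[𝓝 (φ z).2] A.translate ψ χ h ∘ A.translate φ ψ g := by
    have := (Continuous.prodMk_right g).continuousAt (x := (φ z).2)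
      ((isOpen_translateDomain hφ).mem_nhds (mem_translateDomain hφ hgz hz hz'))
    filter_upwards [this] with w hw
    exact (translate_translate hφ hψ hhg hw).symm
  have h2 := (c01At_translate hφ hψ hgz hz hz').differentiableAt
  have h3 := (c01At_translate hψ hχ (hhg.trans (rng_mul hc).symm) hz' hz'').differentiableAt
  have h4 := translate_apply (ψ := ψ) hφ hgz hz
  simp only [jac]
  rw [h1.fderiv_eq, fderiv_comp _ (by rwa [h4]) h2, h4, ContinuousLinearMap.det,
    ContinuousLinearMap.toLinearMap_comp, LinearMap.det_comp, nnnorm_mul]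

theorem jac_unit (hφ : φ ∈ A.rngFamily.charts) {z : G} (hz : z ∈ φ.source) :
    A.jac φ φ (A.rng z) (φ z).2 = 1 := by
  have h1 : A.translate φ φ (A.rng z) =ᶠ[𝓝 (φ z).2] id := by
    have := (Continuous.prodMk_right (A.rng z)).continuousAt (x := (φ z).2)
      (φ.open_target.mem_nhds (mem_target hφ hz))
    filter_upwards [this] with w hw
    exact translate_unit hφ hw
  simp only [jac]
  rw [h1.fderiv_eq, fderiv_id, ContinuousLinearMap.det, ContinuousLinearMap.coe_id,
    LinearMap.det_id, nnnorm_one]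

/-- The Jacobians of `g` and `g⁻¹` multiply to that of a unit, which is 1. -/
theorem jac_pos (hφ : φ ∈ A.rngFamily.charts) (hψ : ψ ∈ A.rngFamily.charts) {g z : G}
    (hgz : A.src g = A.rng z) (hz : z ∈ φ.source) (hz' : A.mul g z ∈ ψ.source) :
    0 < A.jac φ ψ g (φ z).2 := by
  have hc := (A.mem_comp_iff _ _).2 hgz
  have h1 := jac_mul (h := A.inv g) hφ hψ hφ hgz (A.src_inv g) hz hz'
    (by rwa [A.inv_mul_mul _ _ hc])
  have h2 : A.mul (A.inv g) g = A.rng z := congrArg Subtype.val hgz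
  rw [h2, jac_unit hφ hz] at h1
  exact pos_of_ne_zero (right_ne_zero_of_mul_eq_one h1.symm)

theorem continuousAt_jac (hφ : φ ∈ A.rngFamily.charts) (hψ : ψ ∈ A.rngFamily.charts) {g z : G}
    (hgz : A.src g = A.rng z) (hz : z ∈ φ.source) (hz' : A.mul g z ∈ ψ.source) :
    ContinuousAt (fun q : G × Euc k => A.jac φ ψ q.1 q.2) (g, (φ z).2) := by
  have h1 := (c01At_translate hφ hψ hgz hz hz').continuousAt_fderiv
  exact (continuous_nnnorm.comp ContinuousLinearMap.continuous_det).continuousAt.comp h1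

end ContinuousFamilyGroupoid

/-! ### Construction of the invariant density -/

namespace ContinuousFamilyGroupoid

open ArrowGroupoid ContinuousFamily

variable {G : Type*} [TopologicalSpace G] [T2Space G] [LocallyCompactSpace G] {k : ℕ}
  (A : ContinuousFamilyGroupoid G k)

/-- A continuous positive density on the fibers of the range map, given in every chart `φ` by the
function `D φ` on its domain, which is invariant under left translation. As the units act
trivially, this includes the transformation law under changes of charts. -/
structure IsInvariantDensity (D : OpenPartialHomeomorph G (A.units × Euc k) → G → ℝ≥0) : Prop where
  continuousOn : ∀ φ ∈ A.rngFamily.charts, ContinuousOn (D φ) φ.source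
  pos : ∀ φ ∈ A.rngFamily.charts, ∀ x ∈ φ.source, 0 < D φ x
  translate : ∀ φ ∈ A.rngFamily.charts, ∀ ψ ∈ A.rngFamily.charts, ∀ g z : G,
    A.src g = A.rng z → z ∈ φ.source → A.mul g z ∈ ψ.source →
      D φ z = D ψ (A.mul g z) * A.jac φ ψ g (φ z).2

theorem exists_isInvariantDensity [SecondCountableTopology G] :
    ∃ D, A.IsInvariantDensity D := by
  have := A.rngFamily.isFiberSpace.locallyCompact_base
  obtain ⟨f, hf⟩ := PartitionOfUnity.exists_isSubordinate (ι := A.rngFamily.atlas)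
    (X := A.units) isClosed_univ (fun i => {u : A.units | (u : G) ∈ i.1.source})
    (fun i => i.1.open_source.preimage continuous_subtype_val) (fun u _ => by
      obtain ⟨φ, hφ, hu⟩ := A.rngFamily.cover u
      exact mem_iUnion.2 ⟨⟨φ, hφ⟩, hu⟩)
  have hch : ∀ i : A.rngFamily.atlas, i.1 ∈ A.rngFamily.charts := fun i =>
    A.rngFamily.atlas_subset_charts i.2
  -- A nonzero weight forces the unit `x⁻¹x` into the `i`-th chart; elsewhere the Jacobian is a
  -- meaningless value killed by the zero weight.
  have hsrc : ∀ (i : A.rngFamily.atlas) (x : G), f i (A.src x) ≠ 0 →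
      A.mul (A.inv x) x ∈ i.1.source := fun i x hx =>
    hf i (subset_tsupport _ hx)
  have hsub : ∀ (c : A.rngFamily.atlas → ℝ≥0) (u : A.units),
      Function.support (fun i => (f i u).toNNReal * c i) ⊆ f.finsupport u := by
    intro c u i hi
    rw [f.coe_finsupport]
    intro h0
    exact hi (by simp [h0])
  refine ⟨fun φ x => ∑ᶠ i : A.rngFamily.atlas,
    (f i (A.src x)).toNNReal * A.jac φ i.1 (A.inv x) (φ x).2, ?_, ?_, ?_⟩
  · intro φ hφ x hx
    refine ContinuousAt.continuousWithinAt ?_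
    -- Near `x` the sum runs over a fixed finite set of indices, those whose closed support contains
    -- `s(x)`. Subordination of closed supports then makes each Jacobian in it continuous at `x`,
    -- even where the weight vanishes.
    have h1 := A.continuous_src.continuousAt.eventually
      (f.eventually_finsupport_subset (A.src x))
    have h2 : ContinuousAt (fun x' : G => ∑ i ∈ f.fintsupport (A.src x),
        (f i (A.src x')).toNNReal * A.jac φ i.1 (A.inv x') (φ x').2) x := by
      refine tendsto_finsetSum _ fun i hi => ContinuousAt.mul ?_ ?_
      · exact (continuous_real_toNNReal.comp ((f i).continuous.comp A.continuous_src)).continuousAt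
      · have h3 := continuousAt_jac hφ (hch i) (A.src_inv x) hx
          (hf i ((f.mem_fintsupport_iff _ _).1 hi))
        exact ContinuousAt.comp_of_eq (f := fun x' => (A.inv x', (φ x').2)) h3
          (A.continuous_inv.continuousAt.prodMk
            (continuousAt_snd.comp (φ.continuousAt hx))) rfl
    refine h2.congr ?_
    filter_upwards [h1] with x' hx'
    exact (finsum_eq_sum_of_support_subset _ ((hsub _ _).trans (by exact_mod_cast hx'))).symm
  · intro φ hφ x hx
    obtain ⟨i, hi⟩ := f.exists_pos (mem_univ (A.src x))
    rw [finsum_eq_sum_of_support_subset _ (hsub _ _)]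
    refine Finset.sum_pos' (fun _ _ => zero_le) ⟨i, ?_, ?_⟩
    · rw [f.mem_finsupport]
      exact hi.ne'
    · exact mul_pos (Real.toNNReal_pos.2 hi)
        (jac_pos hφ (hch i) (A.src_inv x) hx (hsrc i x hi.ne'))
  · intro φ hφ ψ hψ g z hgz hz hz'
    have hc := (A.mem_comp_iff _ _).2 hgz
    rw [finsum_mul, src_mul hc]
    refine finsum_congr fun i => ?_
    by_cases h0 : f i (A.src z) = 0
    · simp [h0]
    -- Chain rule for `z ↦ gz ↦ (gz)⁻¹gz`, whose composite is translation by `z⁻¹`.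
    have h1 := jac_mul (h := A.inv (A.mul g z)) hφ hψ (hch i) hgz
      ((A.src_inv _).trans (rng_mul hc)) hz hz' (by
        have := hsrc i (A.mul g z)
        rw [src_mul hc] at this
        exact this h0)
    rw [inv_mul_mul_left hc] at h1
    rw [h1, _root_.mul_assoc]

end ContinuousFamilyGroupoid

/-! ### Countable decompositions of measures -/

theorem measurableSet_inter_preimage_of_continuousOn {X Y : Type*} [TopologicalSpace X]
    [MeasurableSpace X] [OpensMeasurableSpace X] [TopologicalSpace Y] [MeasurableSpace Y]
    [BorelSpace Y] {f : X → Y} {s : Set X} {E : Set Y} (hf : ContinuousOn f s)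
    (hs : MeasurableSet s) (hE : MeasurableSet E) : MeasurableSet (s ∩ f ⁻¹' E) := by
  have h := hs.subtype_image ((continuousOn_iff_continuous_domRestrict.1 hf).measurable hE)
  rwa [domRestrict_eq, preimage_comp, Subtype.image_preimage_coe] at h

theorem measure_eq_tsum_inter {X : Type*} [MeasurableSpace X] (μ : Measure X) {B : ℕ → Set X}
    (hB : ∀ n, MeasurableSet (B n)) (hd : Pairwise (Function.onFun Disjoint B))
    (hu : ⋃ n, B n = univ) {E : Set X} (hE : MeasurableSet E) : μ E = ∑' n, μ (E ∩ B n) := by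
  have h := Measure.restrict_iUnion (μ := μ) hd hB
  rw [hu, Measure.restrict_univ] at h
  conv_lhs => rw [h]
  rw [Measure.sum_apply _ hE]
  simp only [Measure.restrict_apply hE]

/-- A continuous family with second countable total space has a countable atlas. -/
theorem ContinuousFamily.exists_seq_charts {X Y : Type*} [TopologicalSpace X] [TopologicalSpace Y]
    [SecondCountableTopology X] [Nonempty X] {p : X → Y} {k : ℕ} (F : ContinuousFamily p k) :
    ∃ c : ℕ → OpenPartialHomeomorph X (Y × Euc k), (∀ n, c n ∈ F.charts) ∧
      ⋃ n, (c n).source = univ := by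
  choose φ hφ hx using F.cover
  obtain ⟨s, hs, hcov⟩ := TopologicalSpace.countable_cover_nhds
    (fun x => (φ x).open_source.mem_nhds (hx x))
  have hne : s.Nonempty := by
    obtain ⟨x⟩ := ‹Nonempty X›
    obtain ⟨y, hy, -⟩ := mem_iUnion₂.1 (hcov ▸ mem_univ x)
    exact ⟨y, hy⟩
  obtain ⟨e, rfl⟩ := hs.exists_eq_range hne
  exact ⟨fun n => φ (e n), fun n => F.atlas_subset_charts (hφ _), by rwa [biUnion_range] at hcov⟩

theorem ContinuousFamily.measure_ext {X Y : Type*} [TopologicalSpace X] [TopologicalSpace Y]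
    [SecondCountableTopology X] [MeasurableSpace X] {p : X → Y} {k : ℕ}
    (F : ContinuousFamily p k) {μ ν : Measure X}
    (h : ∀ φ ∈ F.charts, μ.restrict φ.source = ν.restrict φ.source) : μ = ν := by
  cases isEmpty_or_nonempty X
  · exact Measure.eq_zero_of_isEmpty μ |>.trans (Measure.eq_zero_of_isEmpty ν).symm
  · obtain ⟨c, hc, hu⟩ := F.exists_seq_charts
    exact (Measure.ext_iff_of_iUnion_eq_univ hu).2 fun n => h _ (hc n)

/-! ### Local measures, change of variables and gluing -/

namespace ContinuousFamilyGroupoid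

open ArrowGroupoid ContinuousFamily

variable {G : Type*} [TopologicalSpace G] [T2Space G] [LocallyCompactSpace G] {k : ℕ}
  (A : ContinuousFamilyGroupoid G k)

theorem isOpen_slice (φ : OpenPartialHomeomorph G (A.units × Euc k)) (u : A.units) :
    IsOpen {w : Euc k | (u, w) ∈ φ.target} :=
  φ.open_target.preimage (Continuous.prodMk_right u)

theorem continuousOn_symm_slice (φ : OpenPartialHomeomorph G (A.units × Euc k)) (u : A.units) :
    ContinuousOn (fun w => φ.symm (u, w)) {w : Euc k | (u, w) ∈ φ.target} :=
  φ.symm.continuousOn.comp (Continuous.prodMk_right u).continuousOn fun _ h => h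

theorem isClosed_rng_eq (u : A.units) : IsClosed {z | A.rng z = u} :=
  isClosed_eq A.continuous_rng continuous_const

theorem continuousOn_mul_left (g : G) : ContinuousOn (A.mul g) {z | A.rng z = A.src g} :=
  A.continuousOn_mul.comp (f := fun z => (g, z)) (Continuous.prodMk_right g).continuousOn
    fun _ hz => (A.mem_comp_iff _ _).2 hz.symm

theorem continuous_mul_fiber (g : G) :
    Continuous fun z : A.fiber (A.src g) => A.mul g z :=
  continuousOn_iff_continuous_domRestrict.1 (A.continuousOn_mul_left g)

theorem continuousOn_density_slice {A : ContinuousFamilyGroupoid G k}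
    {D : OpenPartialHomeomorph G (A.units × Euc k) → G → ℝ≥0}
    (hD : A.IsInvariantDensity D) {φ : OpenPartialHomeomorph G (A.units × Euc k)}
    (hφ : φ ∈ A.rngFamily.charts) (u : A.units) :
    ContinuousOn (fun w => D φ (φ.symm (u, w))) {w : Euc k | (u, w) ∈ φ.target} :=
  (hD.continuousOn φ hφ).comp (A.continuousOn_symm_slice φ u) fun _ hw => φ.map_target hw

theorem aemeasurable_density_slice {A : ContinuousFamilyGroupoid G k}
    {D : OpenPartialHomeomorph G (A.units × Euc k) → G → ℝ≥0}
    (hD : A.IsInvariantDensity D) {φ : OpenPartialHomeomorph G (A.units × Euc k)}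
    (hφ : φ ∈ A.rngFamily.charts) (u : A.units) :
    AEMeasurable (fun w => D φ (φ.symm (u, w))) (A.chartLebesgue φ u) :=
  (continuousOn_density_slice hD hφ u).aemeasurable (A.isOpen_slice φ u).measurableSet

theorem chartLebesgue_absolutelyContinuous {A : ContinuousFamilyGroupoid G k}
    {D : OpenPartialHomeomorph G (A.units × Euc k) → G → ℝ≥0}
    (hD : A.IsInvariantDensity D) {φ : OpenPartialHomeomorph G (A.units × Euc k)}
    (hφ : φ ∈ A.rngFamily.charts) (u : A.units) : A.chartLebesgue φ u ≪
      (A.chartLebesgue φ u).withDensity (fun w => (D φ (φ.symm (u, w)) : ℝ≥0∞)) := by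
  refine withDensity_absolutelyContinuous' (aemeasurable_density_slice hD hφ u).coe_nnreal_ennreal
    ((ae_restrict_iff' (A.isOpen_slice φ u).measurableSet).2 (ae_of_all _ fun w hw => ?_))
  exact ENNReal.coe_ne_zero.2 (hD.pos φ hφ _ (φ.map_target hw)).ne'

variable [MeasurableSpace G] [BorelSpace G]
  {D : OpenPartialHomeomorph G (A.units × Euc k) → G → ℝ≥0}
  {φ ψ : OpenPartialHomeomorph G (A.units × Euc k)}

/-- The measure on the domain of the chart `φ` in the fiber over `u` which is given by the
density `D`, as a measure on `G`. -/
noncomputable def localMeasure (D : OpenPartialHomeomorph G (A.units × Euc k) → G → ℝ≥0)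
    (φ : OpenPartialHomeomorph G (A.units × Euc k)) (u : A.units) : Measure G :=
  ((A.chartLebesgue φ u).withDensity (fun w => (D φ (φ.symm (u, w)) : ℝ≥0∞))).map
    (fun w => φ.symm (u, w))

theorem aemeasurable_symm_slice (φ : OpenPartialHomeomorph G (A.units × Euc k)) (u : A.units) :
    AEMeasurable (fun w => φ.symm (u, w)) (A.chartLebesgue φ u) :=
  (A.continuousOn_symm_slice φ u).aemeasurable (A.isOpen_slice φ u).measurableSet

theorem measurableSet_slice (φ : OpenPartialHomeomorph G (A.units × Euc k)) (u : A.units)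
    {E : Set G} (hE : MeasurableSet E) :
    MeasurableSet {w : Euc k | (u, w) ∈ φ.target ∧ φ.symm (u, w) ∈ E} :=
  measurableSet_inter_preimage_of_continuousOn (A.continuousOn_symm_slice φ u)
    (A.isOpen_slice φ u).measurableSet hE

theorem localMeasure_apply (D : OpenPartialHomeomorph G (A.units × Euc k) → G → ℝ≥0)
    (φ : OpenPartialHomeomorph G (A.units × Euc k)) (u : A.units) {E : Set G}
    (hE : MeasurableSet E) : A.localMeasure D φ u E =
      ∫⁻ w in {w : Euc k | (u, w) ∈ φ.target ∧ φ.symm (u, w) ∈ E}, D φ (φ.symm (u, w)) := by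
  rw [localMeasure, Measure.map_apply_of_aemeasurable
    ((A.aemeasurable_symm_slice φ u).mono_ac (withDensity_absolutelyContinuous _ _)) hE]
  -- The preimage of `E` may be nonmeasurable off the chart image, where `φ.symm` is arbitrary;
  -- s-finiteness removes the measurability requirement.
  have : SFinite (A.chartLebesgue φ u) := inferInstanceAs (SFinite (volume.restrict _))
  rw [withDensity_apply', chartLebesgue, Measure.restrict_restrict'
    (A.isOpen_slice φ u).measurableSet, inter_comm]
  rfl

variable {A}

/-- A local measure sees only the part of the fiber over `u` lying in the chart domain. -/
theorem localMeasure_congr (hφ : φ ∈ A.rngFamily.charts) {u : A.units} {E E' : Set G}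
    (hE : MeasurableSet E) (hE' : MeasurableSet E')
    (h : ∀ z ∈ φ.source, A.rng z = u → (z ∈ E ↔ z ∈ E')) :
    A.localMeasure D φ u E = A.localMeasure D φ u E' := by
  rw [localMeasure_apply _ _ _ _ hE, localMeasure_apply _ _ _ _ hE']
  congr 2
  ext w
  exact and_congr_right fun hw => h _ (φ.map_target hw) (proj_symm hφ hw)

theorem localMeasure_restrict (hφ : φ ∈ A.rngFamily.charts) {u : A.units} {s : Set G}
    (hs : MeasurableSet s) (h : ∀ z ∈ φ.source, A.rng z = u → z ∈ s) :
    (A.localMeasure D φ u).restrict s = A.localMeasure D φ u := by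
  ext E hE
  rw [Measure.restrict_apply hE]
  exact localMeasure_congr hφ (hE.inter hs) hE fun z hz hu =>
    ⟨fun h => h.1, fun h' => ⟨h', h z hz hu⟩⟩

variable (A) in
theorem measurableSet_rng_eq (u : A.units) : MeasurableSet {z | A.rng z = u} :=
  (A.isClosed_rng_eq u).measurableSet

variable (A) in
theorem measurableSet_mul_left (g : G) {E : Set G} (hE : MeasurableSet E) :
    MeasurableSet {z | A.rng z = A.src g ∧ A.mul g z ∈ E} :=
  measurableSet_inter_preimage_of_continuousOn (A.continuousOn_mul_left g)
    (A.measurableSet_rng_eq _) hE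

/-- The change of variables formula: the local measures correspond to each other under left
translation. -/
theorem localMeasure_mul_left (hD : A.IsInvariantDensity D) (hφ : φ ∈ A.rngFamily.charts)
    (hψ : ψ ∈ A.rngFamily.charts) (g : G) {E : Set G} (hE : MeasurableSet E) (hEψ : E ⊆ ψ.source)
    (hEφ : {z | A.rng z = A.src g ∧ A.mul g z ∈ E} ⊆ φ.source) :
    A.localMeasure D ψ (A.rng g) E =
      A.localMeasure D φ (A.src g) {z | A.rng z = A.src g ∧ A.mul g z ∈ E} := by
  rw [localMeasure_apply _ _ _ _ hE, localMeasure_apply _ _ _ _ (A.measurableSet_mul_left g hE)]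
  set S := {w : Euc k | (A.src g, w) ∈ φ.target ∧
    φ.symm (A.src g, w) ∈ {z | A.rng z = A.src g ∧ A.mul g z ∈ E}} with hS
  have hSm : MeasurableSet S := A.measurableSet_slice φ _ (A.measurableSet_mul_left g hE)
  have key : ∀ w ∈ S, ∃ z ∈ φ.source, A.src g = A.rng z ∧ A.mul g z ∈ E ∧ (φ z).2 = w ∧
      φ.symm (A.src g, w) = z := by
    intro w hw
    exact ⟨_, φ.map_target hw.1, (proj_symm hφ hw.1).symm, hw.2.2, by rw [φ.right_inv hw.1], rfl⟩
  have hrng : ∀ z, A.src g = A.rng z → A.rng (A.mul g z) = A.rng g := fun z hz =>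
    rng_mul ((A.mem_comp_iff _ _).2 hz)
  have hsymm : ∀ z, A.src g = A.rng z → A.mul g z ∈ E →
      ψ.symm (A.rng g, (ψ (A.mul g z)).2) = A.mul g z := by
    intro z hz hzE
    rw [← hrng z hz]
    exact symm_apply hψ (hEψ hzE)
  -- Surjectivity comes from translating back by `g⁻¹`, which lands in the domain of `φ` by `hEφ`;
  -- the same inverse gives injectivity below.
  have himg : {w : Euc k | (A.rng g, w) ∈ ψ.target ∧ ψ.symm (A.rng g, w) ∈ E} =
      A.translate φ ψ g '' S := by
    ext w
    constructor
    · rintro ⟨hw, hwE⟩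
      have h1 := proj_symm hψ hw
      have h2 := mul_inv_mul h1
      have h3 : A.rng (A.mul (A.inv g) (ψ.symm (A.rng g, w))) = A.src g := by
        rw [rng_mul ((A.mem_comp_iff _ _).2 ((A.src_inv g).trans h1.symm)), A.rng_inv]
      have h4 : A.mul (A.inv g) (ψ.symm (A.rng g, w)) ∈ φ.source := hEφ ⟨h3, by rwa [h2]⟩
      refine ⟨(φ (A.mul (A.inv g) (ψ.symm (A.rng g, w)))).2, ?_, ?_⟩
      · rw [hS, mem_ofPred_eq, ← h3, symm_apply hφ h4]
        exact ⟨mem_target hφ h4, h3 ▸ rfl, by rwa [h2]⟩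
      · rw [translate_apply hφ h3.symm h4, h2, ψ.right_inv hw]
    · rintro ⟨w, hw, rfl⟩
      obtain ⟨z, hz, hzr, hzE, rfl, -⟩ := key w hw
      rw [translate_apply hφ hzr hz, mem_ofPred_eq, hsymm z hzr hzE]
      refine ⟨?_, hzE⟩
      rw [← hrng z hzr]
      exact mem_target hψ (hEψ hzE)
  have hinj : InjOn (A.translate φ ψ g) S := by
    have hleft : ∀ w ∈ S, A.translate ψ φ (A.inv g) (A.translate φ ψ g w) = w := by
      intro w hw
      rw [translate_translate hφ hψ (A.src_inv g) ⟨hw.1, hEψ hw.2.2⟩]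
      exact translate_unit hφ hw.1
    exact fun a ha b hb hab => by rw [← hleft a ha, hab, hleft b hb]
  rw [himg, lintegral_image_eq_lintegral_abs_det_fderiv_mul volume hSm
    (f' := fun w => fderiv ℝ (A.translate φ ψ g) w) ?_ hinj]
  -- The Jacobian factor of the substitution is exactly the one in the transformation law of `D`.
  · refine setLIntegral_congr_fun hSm fun w hw => ?_
    obtain ⟨z, hz, hzr, hzE, rfl, hz'⟩ := key w hw
    rw [hz', translate_apply hφ hzr hz, hsymm z hzr hzE,
      hD.translate φ hφ ψ hψ g z hzr hz (hEψ hzE), ENNReal.coe_mul, mul_comm,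
      ← Real.enorm_eq_ofReal_abs]
    rfl
  · intro w hw
    obtain ⟨z, hz, hzr, hzE, rfl, -⟩ := key w hw
    exact (c01At_translate hφ hψ hzr hz (hEψ hzE)).differentiableAt.hasFDerivAt.hasFDerivWithinAt

/-- The translation formula for the unit `u`, which acts as the identity on its fiber while the
charts differ. -/
theorem localMeasure_restrict_comm (hD : A.IsInvariantDensity D) (hφ : φ ∈ A.rngFamily.charts)
    (hψ : ψ ∈ A.rngFamily.charts) (u : A.units) :
    (A.localMeasure D φ u).restrict ψ.source = (A.localMeasure D ψ u).restrict φ.source := by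
  have hunit : ∀ z, A.rng z = u → A.mul u z = z := by
    rintro z rfl
    exact A.rng_mul_self z
  ext E hE
  have hEφ := hE.inter φ.open_source.measurableSet
  have hEψ := hE.inter ψ.open_source.measurableSet
  have hm := hEψ.inter φ.open_source.measurableSet
  rw [Measure.restrict_apply hE, Measure.restrict_apply hE,
    localMeasure_congr hφ hEψ hm fun z hz _ => ⟨fun h => ⟨h, hz⟩, fun h => h.1⟩,
    localMeasure_congr hψ hEφ hm fun z hz _ => ⟨fun h => ⟨⟨h.1, hz⟩, h.2⟩, fun h => ⟨h.1.1, h.2⟩⟩]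
  have h := localMeasure_mul_left hD hφ hψ (u : G) hm (fun z hz => hz.1.2) (by
    rintro z ⟨hz, hz'⟩
    rw [hunit z (hz.trans (A.src_unit u))] at hz'
    exact hz'.2)
  have hm' := A.measurableSet_mul_left (u : G) hm
  rw [A.rng_unit, A.src_unit] at h
  rw [h]
  rw [A.src_unit] at hm'
  refine localMeasure_congr hφ hm hm' fun z _ hzu => ?_
  rw [mem_ofPred_eq, hunit z hzu]
  exact ⟨fun h => ⟨hzu, h⟩, fun h => h.2⟩

/-- The local measures glue to a measure on the fiber. -/
theorem exists_glued_measure [SecondCountableTopology G] (hD : A.IsInvariantDensity D)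
    (u : A.units) :
    ∃ μ : Measure G, ∀ φ ∈ A.rngFamily.charts, μ.restrict φ.source = A.localMeasure D φ u := by
  have : Nonempty G := ⟨u⟩
  obtain ⟨c, hc, hu⟩ := A.rngFamily.exists_seq_charts
  -- The cover is cut into disjoint pieces, each inside one chart, and the local measures are
  -- summed. Inside `φ.source` every summand can be recomputed in `φ`.
  let B := disjointed fun n => (c n).source
  have hB : ∀ n, MeasurableSet (B n) := fun n =>
    MeasurableSet.disjointed (fun n => (c n).open_source.measurableSet) n
  have hBc : ∀ n, B n ⊆ (c n).source := fun n => disjointed_subset _ n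
  refine ⟨Measure.sum fun n => (A.localMeasure D (c n) u).restrict (B n), fun φ hφ => ?_⟩
  rw [Measure.restrict_sum _ φ.open_source.measurableSet]
  have h1 : ∀ n, ((A.localMeasure D (c n) u).restrict (B n)).restrict φ.source =
      (A.localMeasure D φ u).restrict (B n) := by
    intro n
    rw [Measure.restrict_comm φ.open_source.measurableSet, localMeasure_restrict_comm hD (hc n) hφ,
      Measure.restrict_restrict (hB n), inter_eq_left.2 (hBc n)]
  simp only [h1]
  rw [← Measure.restrict_iUnion (disjoint_disjointed _) hB, iUnion_disjointed, hu,
    Measure.restrict_univ]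

end ContinuousFamilyGroupoid

/-! ### The glued measures form a continuous Haar system -/

namespace ContinuousFamilyGroupoid

open ArrowGroupoid ContinuousFamily

variable {G : Type*} [TopologicalSpace G] [T2Space G] [LocallyCompactSpace G] {k : ℕ}
  [MeasurableSpace G] [BorelSpace G] (A : ContinuousFamilyGroupoid G k)
  {D : OpenPartialHomeomorph G (A.units × Euc k) → G → ℝ≥0}
  {φ ψ : OpenPartialHomeomorph G (A.units × Euc k)} {μ : A.units → Measure G}

/-- The measures `μ u` on `G` are given by the density `D` in all charts. -/
def IsGlued (D : OpenPartialHomeomorph G (A.units × Euc k) → G → ℝ≥0)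
    (μ : A.units → Measure G) : Prop :=
  ∀ u, ∀ φ ∈ A.rngFamily.charts, (μ u).restrict φ.source = A.localMeasure D φ u

/-- The measure `μ u`, as a measure on the fiber over `u`. -/
noncomputable def fiberMeasure (μ : A.units → Measure G) (u : A.units) : Measure (A.fiber u) :=
  (μ u).comap Subtype.val

variable {A}

namespace IsGlued

theorem apply_of_subset (hμ : A.IsGlued D μ) (hφ : φ ∈ A.rngFamily.charts) (u : A.units)
    {E : Set G} (hE : MeasurableSet E) (h : E ⊆ φ.source) : μ u E = A.localMeasure D φ u E := by
  rw [← hμ u φ hφ, Measure.restrict_apply hE, inter_eq_left.2 h]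

theorem restrict_fiber [SecondCountableTopology G] (hμ : A.IsGlued D μ) (u : A.units) :
    (μ u).restrict {z | A.rng z = u} = μ u := by
  refine A.rngFamily.measure_ext fun φ hφ => ?_
  rw [Measure.restrict_comm φ.open_source.measurableSet, hμ u φ hφ]
  exact localMeasure_restrict hφ (A.measurableSet_rng_eq u) fun z _ hz => hz

theorem map_fiberMeasure [SecondCountableTopology G] (hμ : A.IsGlued D μ) (u : A.units) :
    (A.fiberMeasure μ u).map Subtype.val = μ u :=
  (map_comap_subtype_coe (A.measurableSet_rng_eq u) (μ u)).trans (hμ.restrict_fiber u)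

theorem fiberMeasure_preimage [SecondCountableTopology G] (hμ : A.IsGlued D μ) (u : A.units)
    {E : Set G} (hE : MeasurableSet E) :
    A.fiberMeasure μ u (Subtype.val ⁻¹' E) = μ u E := by
  rw [← Measure.map_apply measurable_subtype_coe hE, hμ.map_fiberMeasure]

theorem integral_fiberMeasure [SecondCountableTopology G] (hμ : A.IsGlued D μ) (u : A.units)
    (g : G → ℂ) : ∫ x : A.fiber u, g x ∂A.fiberMeasure μ u = ∫ x, g x ∂μ u := by
  conv_rhs => rw [← hμ.map_fiberMeasure u]
  exact ((MeasurableEmbedding.subtype_coe (A.measurableSet_rng_eq u)).integral_map g).symm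

/-- Removes from `localMeasure_mul_left` the requirement that the translate of `E` back along `g`
lie in one chart. -/
theorem localMeasure_rng_eq [SecondCountableTopology G] (hμ : A.IsGlued D μ)
    (hD : A.IsInvariantDensity D) (hψ : ψ ∈ A.rngFamily.charts) (g : G) {E : Set G}
    (hE : MeasurableSet E) (hEψ : E ⊆ ψ.source) :
    A.localMeasure D ψ (A.rng g) E = μ (A.src g) {z | A.rng z = A.src g ∧ A.mul g z ∈ E} := by
  have : Nonempty G := ⟨g⟩
  obtain ⟨c, hc, hu⟩ := A.rngFamily.exists_seq_charts
  let B := disjointed fun n => (c n).source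
  have hB : ∀ n, MeasurableSet (B n) := fun n =>
    MeasurableSet.disjointed (fun n => (c n).open_source.measurableSet) n
  have hBc : ∀ n, B n ⊆ (c n).source := fun n => disjointed_subset _ n
  have hBd : Pairwise (Function.onFun Disjoint B) := disjoint_disjointed _
  have hBu : ⋃ n, B n = univ := iUnion_disjointed.trans hu
  -- `E` is cut according to the piece `B n` containing `g⁻¹y`.
  let T : ℕ → Set G := fun n => {y | A.rng y = A.rng g ∧ A.mul (A.inv g) y ∈ B n}
  have hT : ∀ n, MeasurableSet (T n) := fun n => by
    have := A.measurableSet_mul_left (A.inv g) (hB n)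
    rwa [A.src_inv] at this
  have hTd : Pairwise (Function.onFun Disjoint fun n => E ∩ T n) := fun m n hmn =>
    disjoint_left.2 fun y hy hy' => disjoint_left.1 (hBd hmn) hy.2.2 hy'.2.2
  have h1 : A.localMeasure D ψ (A.rng g) E = A.localMeasure D ψ (A.rng g) (⋃ n, E ∩ T n) := by
    refine localMeasure_congr hψ hE (MeasurableSet.iUnion fun n => hE.inter (hT n))
      fun z _ hz => ⟨fun h => ?_, fun h => ?_⟩
    · obtain ⟨n, hn⟩ := mem_iUnion.1 (hBu ▸ mem_univ (A.mul (A.inv g) z))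
      exact mem_iUnion.2 ⟨n, h, hz, hn⟩
    · obtain ⟨n, hn⟩ := mem_iUnion.1 h
      exact hn.1
  rw [h1, measure_iUnion hTd fun n => hE.inter (hT n),
    measure_eq_tsum_inter _ hB hBd hBu (A.measurableSet_mul_left g hE)]
  refine tsum_congr fun n => ?_
  have h2 : {z | A.rng z = A.src g ∧ A.mul g z ∈ E ∩ T n} =
      {z | A.rng z = A.src g ∧ A.mul g z ∈ E} ∩ B n := by
    ext z
    constructor
    · rintro ⟨hz, hzE, -, hzB⟩
      rw [A.inv_mul_mul _ _ ((A.mem_comp_iff _ _).2 hz.symm)] at hzB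
      exact ⟨⟨hz, hzE⟩, hzB⟩
    · rintro ⟨⟨hz, hzE⟩, hzB⟩
      have hcomp := (A.mem_comp_iff _ _).2 hz.symm
      refine ⟨hz, hzE, rng_mul hcomp, ?_⟩
      rwa [A.inv_mul_mul _ _ hcomp]
  have h3 : {z | A.rng z = A.src g ∧ A.mul g z ∈ E} ∩ B n ⊆ (c n).source := fun z hz => hBc n hz.2
  rw [hμ.apply_of_subset (hc n) _ ((A.measurableSet_mul_left g hE).inter (hB n)) h3, ← h2]
  exact localMeasure_mul_left hD (hc n) hψ g (hE.inter (hT n)) (fun y hy => hEψ hy.1)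
    (by rw [h2]; exact h3)

/-- The glued measures are invariant under left translation. -/
theorem map_mul_left [SecondCountableTopology G] (hμ : A.IsGlued D μ)
    (hD : A.IsInvariantDensity D) (g : G) :
    (A.fiberMeasure μ (A.src g)).map (fun z : A.fiber (A.src g) => A.mul g z) = μ (A.rng g) := by
  refine A.rngFamily.measure_ext fun ψ hψ => ?_
  ext E hE
  have hEψ := hE.inter ψ.open_source.measurableSet
  rw [hμ _ ψ hψ, Measure.restrict_apply hE,
    Measure.map_apply (A.continuous_mul_fiber g).measurable hEψ,
    localMeasure_congr hψ hE hEψ fun z hz _ => ⟨fun h => ⟨h, hz⟩, fun h => h.1⟩,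
    hμ.localMeasure_rng_eq hD hψ g hEψ inter_subset_right,
    ← hμ.fiberMeasure_preimage _ (A.measurableSet_mul_left g hEψ)]
  congr 1
  ext z
  exact ⟨fun h => ⟨z.2, h⟩, fun h => h.2⟩

theorem chartMeasure_eq [SecondCountableTopology G] (hμ : A.IsGlued D μ)
    (hφ : φ ∈ A.rngFamily.charts) (u : A.units) :
    A.chartMeasure φ u (A.fiberMeasure μ u) =
      (A.chartLebesgue φ u).withDensity (fun w => (D φ (φ.symm (u, w)) : ℝ≥0∞)) := by
  have hso : IsOpen {x : A.fiber u | (x : G) ∈ φ.source} :=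
    φ.open_source.preimage continuous_subtype_val
  have hc : ContinuousOn (fun x : G => (φ x).2) φ.source := continuous_snd.comp_continuousOn
    φ.continuousOn
  have hc' : ContinuousOn (fun x : A.fiber u => (φ (x : G)).2) {x | (x : G) ∈ φ.source} :=
    hc.comp continuous_subtype_val.continuousOn fun x hx => hx
  ext S hS
  have hE := measurableSet_inter_preimage_of_continuousOn hc φ.open_source.measurableSet hS
  rw [chartMeasure, Measure.map_apply_of_aemeasurable (hc'.aemeasurable hso.measurableSet) hS,
    Measure.restrict_apply' hso.measurableSet, inter_comm]
  refine (hμ.fiberMeasure_preimage u hE).trans ?_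
  rw [hμ.apply_of_subset hφ u hE inter_subset_left, localMeasure_apply _ _ _ _ hE,
    withDensity_apply _ hS, chartLebesgue, Measure.restrict_restrict hS]
  congr 2
  ext w
  constructor
  · rintro ⟨hw, -, hw'⟩
    rw [mem_preimage, φ.right_inv hw] at hw'
    exact ⟨hw', hw⟩
  · rintro ⟨hw', hw⟩
    refine ⟨hw, φ.map_target hw, ?_⟩
    rwa [mem_preimage, φ.right_inv hw]

theorem isLocallyFiniteMeasure [SecondCountableTopology G] (hμ : A.IsGlued D μ)
    (hD : A.IsInvariantDensity D) (u : A.units) : IsLocallyFiniteMeasure (μ u) := by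
  refine ⟨fun x => ?_⟩
  by_cases hx : A.rng x = u
  · subst hx
    obtain ⟨φ, hφ, hxφ⟩ := A.rngFamily.cover x
    replace hφ := A.rngFamily.atlas_subset_charts hφ
    have h1 := (A.isOpen_slice φ (A.rng x)).mem_nhds (mem_target hφ hxφ)
    have h2 := (continuousOn_density_slice hD hφ (A.rng x)).continuousAt h1
    -- By continuity any constant above the density at `x` bounds it nearby; the unit ball only
    -- ensures finite volume.
    obtain ⟨C, hC⟩ := exists_gt (D φ (φ.symm (A.rng x, (φ x).2)))
    obtain ⟨O, hO, hOo, hxO⟩ := mem_nhds_iff.1 (inter_mem (h2.eventually_lt_const hC)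
      (Metric.ball_mem_nhds (φ x).2 one_pos))
    have hEo : IsOpen (φ.source ∩ φ ⁻¹' (univ ×ˢ O)) :=
      φ.isOpen_inter_preimage (isOpen_univ.prod hOo)
    refine ⟨_, hEo.mem_nhds ⟨hxφ, mem_univ _, hxO⟩, ?_⟩
    rw [hμ.apply_of_subset hφ _ hEo.measurableSet inter_subset_left,
      localMeasure_apply _ _ _ _ hEo.measurableSet]
    calc _ ≤ ∫⁻ w in O, D φ (φ.symm (A.rng x, w)) := by
            refine lintegral_mono_set ?_
            rintro w ⟨hw, -, -, hw'⟩
            rwa [φ.right_inv hw] at hw'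
      _ ≤ ∫⁻ _ in O, (C : ℝ≥0∞) := setLIntegral_mono' hOo.measurableSet fun w hw =>
            ENNReal.coe_le_coe.2 (hO hw).1.le
      _ = C * volume O := setLIntegral_const _ _
      _ < ⊤ := ENNReal.mul_lt_top ENNReal.coe_lt_top
            ((measure_mono fun w hw => (hO hw).2).trans_lt measure_ball_lt_top)
  · refine ⟨_, (A.isClosed_rng_eq u).isOpen_compl.mem_nhds hx, ?_⟩
    rw [← hμ.restrict_fiber u, Measure.restrict_apply (A.measurableSet_rng_eq u).compl,
      compl_inter_self, measure_empty]
    exact ENNReal.zero_lt_top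

theorem isLocallyFiniteMeasure_fiberMeasure [SecondCountableTopology G] (hμ : A.IsGlued D μ)
    (hD : A.IsInvariantDensity D) (u : A.units) :
    IsLocallyFiniteMeasure (A.fiberMeasure μ u) := by
  have := hμ.isLocallyFiniteMeasure hD u
  refine ⟨fun x => ?_⟩
  obtain ⟨s, hxs, hso, hs⟩ := (μ u).exists_isOpen_measure_lt_top x
  exact ⟨_, continuous_subtype_val.continuousAt (hso.mem_nhds hxs),
    (hμ.fiberMeasure_preimage u hso.measurableSet).trans_lt hs⟩

/-- In a chart a nonempty open set becomes a nonempty open subset of `ℝ^k`, and positivity of the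
density prevents it from being null. -/
theorem isOpenPosMeasure_fiberMeasure [SecondCountableTopology G] (hμ : A.IsGlued D μ)
    (hD : A.IsInvariantDensity D) (u : A.units) :
    (A.fiberMeasure μ u).IsOpenPosMeasure := by
  refine ⟨?_⟩
  rintro _ ⟨V, hV, rfl⟩ ⟨x, hx⟩ h0
  obtain ⟨φ, hφ, hxφ⟩ := A.rngFamily.cover x
  replace hφ := A.rngFamily.atlas_subset_charts hφ
  have hE := (hV.inter φ.open_source).measurableSet
  rw [hμ.fiberMeasure_preimage u hV.measurableSet] at h0
  have h1 := measure_mono_null inter_subset_left h0 (s := V ∩ φ.source)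
  rw [hμ.apply_of_subset hφ u hE inter_subset_right, localMeasure,
    Measure.map_apply_of_aemeasurable
      ((A.aemeasurable_symm_slice φ u).mono_ac (withDensity_absolutelyContinuous _ _)) hE] at h1
  have h2 := chartLebesgue_absolutelyContinuous hD hφ u h1
  rw [chartLebesgue, Measure.restrict_apply' (A.isOpen_slice φ u).measurableSet, inter_comm] at h2
  have h3 := ((A.continuousOn_symm_slice φ u).isOpen_inter_preimage (A.isOpen_slice φ u)
    (hV.inter φ.open_source))
  have h4 := mem_target hφ hxφ
  have h5 := symm_apply hφ hxφ
  rw [x.2] at h4 h5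
  refine (h3.measure_pos volume ⟨(φ x).2, h4, ?_⟩).ne' h2
  rw [mem_preimage, h5]
  exact ⟨hx, hxφ⟩

/-- Extension by zero gives an integral over all of `ℝ^k`, with `u` occurring only in the integrand.
-/
theorem integral_eq_of_tsupport_subset (hμ : A.IsGlued D μ) (hD : A.IsInvariantDensity D)
    (hφ : φ ∈ A.rngFamily.charts) {g : G → ℂ} (hg : Continuous g) (hgφ : tsupport g ⊆ φ.source)
    [SecondCountableTopology G] (u : A.units) : ∫ x, g x ∂μ u =
      ∫ w, φ.target.indicator (fun q => D φ (φ.symm q) • g (φ.symm q)) (u, w) := by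
  rw [← setIntegral_eq_integral_of_forall_compl_eq_zero (s := φ.source)
    fun x hx => image_eq_zero_of_notMem_tsupport fun h => hx (hgφ h), hμ u φ hφ, localMeasure,
    integral_map ((A.aemeasurable_symm_slice φ u).mono_ac (withDensity_absolutelyContinuous _ _))
      hg.aestronglyMeasurable,
    integral_withDensity_eq_integral_smul₀ (aemeasurable_density_slice hD hφ u), chartLebesgue,
    ← integral_indicator (A.isOpen_slice φ u).measurableSet]
  rfl

theorem continuous_integral_of_tsupport_subset [SecondCountableTopology G] (hμ : A.IsGlued D μ)
    (hD : A.IsInvariantDensity D) (hφ : φ ∈ A.rngFamily.charts) {g : G → ℂ} (hg : Continuous g)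
    (hgc : HasCompactSupport g) (hgφ : tsupport g ⊆ φ.source) :
    Continuous fun u => ∫ x, g x ∂μ u := by
  simp only [hμ.integral_eq_of_tsupport_subset hD hφ hg hgφ]
  have := A.rngFamily.isFiberSpace.locallyCompact_base
  have hK : IsCompact (φ '' tsupport g) := hgc.isCompact.image_of_continuousOn
    (φ.continuousOn.mono hgφ)
  have hout : ∀ q ∉ φ '' tsupport g,
      φ.target.indicator (fun q => D φ (φ.symm q) • g (φ.symm q)) q = 0 := by
    intro q hq
    by_cases hqt : q ∈ φ.target
    · rw [indicator_of_mem hqt, image_eq_zero_of_notMem_tsupport (f := g), smul_zero]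
      exact fun h => hq ⟨_, h, φ.right_inv hqt⟩
    · exact indicator_of_notMem hqt _
  -- The zero extension stays continuous because the image of the support is compact, hence closed,
  -- inside the open chart image.
  have hcont : Continuous (φ.target.indicator fun q => D φ (φ.symm q) • g (φ.symm q)) := by
    rw [continuous_iff_continuousAt]
    intro q
    by_cases hqt : q ∈ φ.target
    · have h1 : ContinuousOn (fun q => D φ (φ.symm q) • g (φ.symm q)) φ.target :=
        ((hD.continuousOn φ hφ).comp φ.symm.continuousOn φ.symm.mapsTo).smul
          (hg.comp_continuousOn φ.symm.continuousOn)
      refine (h1.continuousAt (φ.open_target.mem_nhds hqt)).congr ?_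
      filter_upwards [φ.open_target.mem_nhds hqt] with q' hq'
      rw [indicator_of_mem hq']
    · have hq : q ∉ φ '' tsupport g := by
        rintro ⟨x, hx, rfl⟩
        exact hqt (φ.map_source (hgφ hx))
      refine (continuousAt_const (y := (0 : ℂ))).congr ?_
      filter_upwards [hK.isClosed.isOpen_compl.mem_nhds hq] with q' hq'
      rw [hout q' hq']
  rw [← continuousOn_univ]
  -- One compact set, the projection of the support to `ℝ^k`, serves for all `u`.
  refine continuousOn_integral_of_compact_support (hK.image continuous_snd) hcont.continuousOn ?_
  intro u w _ hw
  exact hout _ fun h => hw ⟨_, h, rfl⟩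

theorem continuous_integral [SecondCountableTopology G] (hμ : A.IsGlued D μ)
    (hD : A.IsInvariantDensity D) {g : G → ℂ} (hg : Continuous g) (hgc : HasCompactSupport g) :
    Continuous fun u => ∫ x, g x ∂μ u := by
  choose φ hφ hx using A.rngFamily.cover
  obtain ⟨t, ht⟩ := hgc.isCompact.elim_finite_subcover (fun x => (φ x).source)
    (fun x => (φ x).open_source) fun x _ => mem_iUnion.2 ⟨x, hx x⟩
  obtain ⟨f, hf, hf1, -, hfc⟩ := exists_continuous_sum_one_of_isOpen_isCompact
    (s := fun i : Fin t.card => (φ (t.equivFin.symm i)).source)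
    (fun i => (φ _).open_source) hgc.isCompact (fun x hx => by
      obtain ⟨y, hy, hxy⟩ := mem_iUnion₂.1 (ht hx)
      refine mem_iUnion.2 ⟨t.equivFin ⟨y, hy⟩, ?_⟩
      simpa using hxy)
  have hfg : ∀ i, Continuous fun x => f i x • g x := fun i => (f i).continuous.smul hg
  have hfgc : ∀ i, HasCompactSupport fun x => f i x • g x := fun i => (hfc i).smul_right
  have hsum : ∀ x, g x = ∑ i, f i x • g x := by
    intro x
    rw [← Finset.sum_smul]
    by_cases hx : x ∈ tsupport g
    · have := hf1 hx
      rw [Finset.sum_apply, Pi.one_apply] at this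
      rw [this, one_smul]
    · rw [image_eq_zero_of_notMem_tsupport hx, smul_zero]
  have heq : ∀ u, ∫ x, g x ∂μ u = ∑ i, ∫ x, f i x • g x ∂μ u := by
    intro u
    have := hμ.isLocallyFiniteMeasure hD u
    rw [← integral_finsetSum _ fun i _ => (hfg i).integrable_of_hasCompactSupport (hfgc i)]
    exact integral_congr_ae (ae_of_all _ hsum)
  simp only [heq]
  refine continuous_finsetSum _ fun i _ => ?_
  exact hμ.continuous_integral_of_tsupport_subset hD (A.rngFamily.atlas_subset_charts (hφ _))
    (hfg i) (hfgc i) ((tsupport_smul_subset_left _ _).trans (hf i))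

theorem isLeftHaarSystem [SecondCountableTopology G] (hμ : A.IsGlued D μ)
    (hD : A.IsInvariantDensity D) : A.IsLeftHaarSystem (A.fiberMeasure μ) where
  regular u := by
    -- On a locally compact, second countable, metrizable fiber, local finiteness already implies
    -- regularity.
    have := hμ.isLocallyFiniteMeasure_fiberMeasure hD u
    have : LocallyCompactSpace (A.fiber u) := (A.isClosed_rng_eq u).locallyCompactSpace
    have : SecondCountableTopology (A.fiber u) :=
      TopologicalSpace.Subtype.secondCountableTopology {z | A.rng z = u}
    have : TopologicalSpace.MetrizableSpace (A.fiber u) :=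
      TopologicalSpace.metrizableSpace_of_t3_secondCountable _
    infer_instance
  support_eq u := by
    have := hμ.isOpenPosMeasure_fiberMeasure hD u
    exact Measure.support_eq_univ
  continuous_integral g hg hgc := by
    simp only [hμ.integral_fiberMeasure]
    refine ⟨hμ.continuous_integral hD hg hgc,
      HasCompactSupport.intro (hgc.isCompact.image A.continuous_rng) fun u hu => ?_⟩
    rw [← hμ.integral_fiberMeasure]
    refine integral_eq_zero_of_ae (ae_of_all _ fun x => ?_)
    exact image_eq_zero_of_notMem_tsupport fun h => hu ⟨x, h, x.2⟩
  left_invariant g f hf _ := by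
    rw [hμ.integral_fiberMeasure, ← hμ.map_mul_left hD, integral_map
      (A.continuous_mul_fiber g).measurable.aemeasurable hf.aestronglyMeasurable]

theorem isContinuousLeftHaarSystem [SecondCountableTopology G] (hμ : A.IsGlued D μ)
    (hD : A.IsInvariantDensity D) : A.IsContinuousLeftHaarSystem (A.fiberMeasure μ) where
  toIsLeftHaarSystem := hμ.isLeftHaarSystem hD
  absolutelyContinuous φ hφ u _ := by
    rw [hμ.chartMeasure_eq hφ]
    exact ⟨withDensity_absolutelyContinuous _ _, chartLebesgue_absolutelyContinuous hD hφ u⟩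
  continuous_density φ hφ := ⟨fun q => D φ (φ.symm q),
    (hD.continuousOn φ hφ).comp φ.symm.continuousOn φ.symm.mapsTo,
    fun u _ => hμ.chartMeasure_eq hφ u⟩

end IsGlued

end ContinuousFamilyGroupoid

end CFGpd

theorem theorem3p3 {G : Type*} [TopologicalSpace G] [T2Space G] [LocallyCompactSpace G]
    [SecondCountableTopology G] [MeasurableSpace G] [BorelSpace G] {k : ℕ}
    (A : CFGpd.ContinuousFamilyGroupoid G k) :
    ∃ lam : ∀ u : A.units, MeasureTheory.Measure (A.fiber u),
      A.IsContinuousLeftHaarSystem lam := by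
  obtain ⟨D, hD⟩ := A.exists_isInvariantDensity
  choose μ hμ using CFGpd.ContinuousFamilyGroupoid.exists_glued_measure hD
  exact ⟨A.fiberMeasure μ,
    CFGpd.ContinuousFamilyGroupoid.IsGlued.isContinuousLeftHaarSystem hμ hD⟩
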